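/- Let $K\ge 2$, $h>0$, $\sigma_X^2>0$. Let the states $X_1,\dots,X_K\sim\mathcal N(0,\sigma_X^2)$, the measurement noises $Z_1,\dots,Z_K\sim\mathcal N(0,1)$ and the quantization noises $Q_1,\dots,Q_K\sim\mathcal N(0,\sigma_Q^2)$ all be independent, and let agent $k$ measure $Y_k=X_k+\sum_{l\ne k}\sqrt h\,X_l+Z_k$. In Gaussian local encoding agent $k$ broadcasts $U_k=Y_k+Q_k$; in Gaussian progressive encoding, with real coefficients $a=(a_{k,l})_{l<k}$, it broadcasts $\tilde U_k=Y_k+\sum_{l<k}a_{k,l}\tilde U_l+Q_k$. In the distributed round-robin protocol the rates required for $\sigma_Q^2>0$ are $$R_k=I(U_k;Y_k)-\min_{l\ne k}I(U_k;Y_lU_1\dots U_{k-1}),\qquad \tilde R_k=I(\tilde U_k;Y_k\tilde U_1\dots\tilde U_{k-1})-\min_{l\ne k}I(\tilde U_k;Y_l\tilde U_1\dots\tilde U_{k-1}),$$ the distortions are $D_k=E[\operatorname{var}(X_k|Y_kU_1\dots U_K)]$ and $\tilde D_k=E[\operatorname{var}(X_k|Y_k\tilde U_1\dots\tilde U_K)]$,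 and the leakages about agent $k$ at agent $j\neq k$ are $L_k^{(j)}=I(X_k;Y_jU_1\dots U_K)$ and $\tilde L_k^{(j)}=I(X_k;Y_j\tilde U_1\dots\tilde U_K)$. A scheme achieves a tuple of rates, distortions and leakages if, for some $\sigma_Q^2>0$ (and, for progressive encoding, some $a$), each entry is at least the corresponding quantity above. All logarithms are to base $2$. Then local encoding and progressive encoding achieve the same set of rate–distortion–leakage tuples. More precisely: (i) For every $\sigma_Q^2>0$, every $a$ and every $k$, the mutual informations in $R_k$ and $\tilde R_k$ are finite, and $\tilde R_k=R_k$, which equals $I(U_k;Y_k)-I(U_k;Y_1U_1\dots U_{k-1})$ for $k>1$ and $I(U_1;Y_1)-I(U_1;Y_2)$ for $k=1$. (ii) For every $\sigma_Q^2\ge 0$, $a$ and $k$, $\tilde D_k=D_k$. (iii) For every $\sigma_Q^2\ge0$, $a$ and $k\ne j$, $\tilde L_k^{(j)}=L_k^{(j)}<\infty$. With $\alpha=\sigma_X^2(1+h(K-1))+1$, $\beta=\sigma_X^2(2\sqrt h+h(K-2))$, $f_1(K,c)=\alpha+(K-2)\beta-(K-1)c$ and $c_5=\frac{(\beta-\sqrt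 h\,\sigma_X^2)^2}{\alpha-\sigma_X^2+\sigma_Q^2}+h\sigma_X^2$, this leakage equals $$\frac12\log\frac{\alpha\,(\alpha-\beta+\sigma_Q^2)\,\big(f_1(K,\beta^2/\alpha)+\sigma_Q^2\big)}{(\alpha-\sigma_X^2+\sigma_Q^2)\,\big[(\alpha-\beta)\big(f_1(K,c_5)+\sigma_Q^2\big)+\sigma_Q^2(\beta-c_5)\big]},$$ which for $\sigma_Q^2=0$ is $\frac12\log\frac{\alpha f_1(K,\beta^2/\alpha)}{(\alpha-\sigma_X^2)f_1(K,c_5)}$. -/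

import Mathlib

open MeasureTheory ProbabilityTheory InformationTheory
open scoped NNReal ENNReal

noncomputable section

/-- The mutual information `I(A; B)`, in bits, of two random elements on a probability space:
the Kullback-Leibler divergence of the joint law from the product of the marginal laws. -/
def mutualInfo {Ω α β : Type*} [MeasurableSpace Ω] [MeasurableSpace α] [MeasurableSpace β]
    (P : Measure Ω) (A : Ω → α) (B : Ω → β) : ℝ≥0∞ :=
  klDiv (P.map (fun ω => (A ω, B ω))) ((P.map A).prod (P.map B)) / ENNReal.ofReal (Real.log 2)

/-- The minimum mean square error `E[var(A | B)]` of estimating `A` from `B`. -/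
def meanCondVar {Ω β : Type*} [MeasurableSpace Ω] [mβ : MeasurableSpace β]
    (P : Measure Ω) (A : Ω → ℝ) (B : Ω → β) : ℝ :=
  ∫ ω, condVar (mβ.comap B) A P ω ∂P

namespace MultiAgent

/-- A joint realization of the states `X`, the measurement noises `Z` and the quantization
noises `Q` of the `K` agents. -/
abbrev Sample (K : ℕ) : Type := (Fin K → ℝ) × (Fin K → ℝ) × (Fin K → ℝ)

/-- The law under which all states, measurement noises and quantization noises are independent,
the states being `N(0, σX2)`, the measurement noises `N(0, 1)` and the quantization noises
`N(0, σQ2)` (the second argument of `gaussianReal` is the variance). -/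
def law (K : ℕ) (σX2 σQ2 : ℝ≥0) : Measure (Sample K) :=
  (Measure.pi fun _ : Fin K => gaussianReal 0 σX2).prod
    ((Measure.pi fun _ : Fin K => gaussianReal 0 1).prod
      (Measure.pi fun _ : Fin K => gaussianReal 0 σQ2))

/-- The state `X_k` of agent `k`. -/
def state {K : ℕ} (k : Fin K) (ω : Sample K) : ℝ := ω.1 k

/-- The measurement `Y_k = X_k + ∑_{l ≠ k} √h X_l + Z_k` of agent `k`. -/
def meas {K : ℕ} (h : ℝ) (k : Fin K) (ω : Sample K) : ℝ :=
  ω.1 k + (∑ l ∈ Finset.univ.erase k, Real.sqrt h * ω.1 l) + ω.2.1 k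

/-- The local Gaussian codeword symbol `U_k = Y_k + Q_k`. -/
def localMsg {K : ℕ} (h : ℝ) (k : Fin K) (ω : Sample K) : ℝ :=
  meas h k ω + ω.2.2 k

/-- The progressive Gaussian codeword symbol `Ũ_k = Y_k + ∑_{l < k} a_{k,l} Ũ_l + Q_k`. -/
def progMsg {K : ℕ} (h : ℝ) (a : Fin K → Fin K → ℝ) (k : Fin K) (ω : Sample K) : ℝ :=
  meas h k ω + (∑ l : Set.Iio k, a k l * progMsg h a l.1 ω) + ω.2.2 k
termination_by k.val
decreasing_by exact l.2

/-- The pair consisting of `Y_l` and the earlier broadcasts `(U_j)_{j < k}`. -/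
def measAndPast {K : ℕ} (h : ℝ) (U : Fin K → Sample K → ℝ) (l k : Fin K) (ω : Sample K) :
    ℝ × (Set.Iio k → ℝ) :=
  (meas h l ω, fun j => U j.1 ω)

/-- The pair consisting of `Y_l` and all the broadcasts `(U_1, …, U_K)`. -/
def measAndAll {K : ℕ} (h : ℝ) (U : Fin K → Sample K → ℝ) (l : Fin K) (ω : Sample K) :
    ℝ × (Fin K → ℝ) :=
  (meas h l ω, fun j => U j ω)

/-- The rate at which agent `k` has to broadcast under local encoding:
`I(U_k; Y_k) - min_{l ≠ k} I(U_k; Y_l U_1 … U_{k-1})`. -/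
def localRate (K : ℕ) (h : ℝ) (σX2 σQ2 : ℝ≥0) (k : Fin K) : ℝ :=
  (mutualInfo (law K σX2 σQ2) (localMsg h k) (meas h k)).toReal
    - ⨅ l : {l : Fin K // l ≠ k},
        (mutualInfo (law K σX2 σQ2) (localMsg h k)
          (measAndPast h (localMsg h) l.1 k)).toReal

/-- The rate at which agent `k` has to broadcast under progressive encoding:
`I(Ũ_k; Y_k Ũ_1 … Ũ_{k-1}) - min_{l ≠ k} I(Ũ_k; Y_l Ũ_1 … Ũ_{k-1})`. -/
def progRate (K : ℕ) (h : ℝ) (σX2 σQ2 : ℝ≥0) (a : Fin K → Fin K → ℝ) (k : Fin K) : ℝ :=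
  (mutualInfo (law K σX2 σQ2) (progMsg h a k) (measAndPast h (progMsg h a) k k)).toReal
    - ⨅ l : {l : Fin K // l ≠ k},
        (mutualInfo (law K σX2 σQ2) (progMsg h a k)
          (measAndPast h (progMsg h a) l.1 k)).toReal

/-- The distortion `E[var(X_k | Y_k U_1 … U_K)]` at agent `k` for the broadcasts `U`. -/
def distortion {K : ℕ} (h : ℝ) (σX2 σQ2 : ℝ≥0) (U : Fin K → Sample K → ℝ) (k : Fin K) : ℝ :=
  meanCondVar (law K σX2 σQ2) (state k) (measAndAll h U k)

/-- The leakage `I(X_k; Y_j U_1 … U_K)` about the state of agent `k` at agent `j` for the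
broadcasts `U`. -/
def leakage {K : ℕ} (h : ℝ) (σX2 σQ2 : ℝ≥0) (U : Fin K → Sample K → ℝ) (k j : Fin K) : ℝ≥0∞ :=
  mutualInfo (law K σX2 σQ2) (state k) (measAndAll h U j)

/-- A rate-distortion-leakage tuple: `R_k` and `D_k` for all agents `k`, and `L_k^{(j)}` for all
pairs `(k, j)` of different agents. -/
structure RDLTuple (K : ℕ) where
  R : Fin K → ℝ
  D : Fin K → ℝ
  L : {p : Fin K × Fin K // p.1 ≠ p.2} → ℝ

/-- The rate-distortion-leakage tuples achieved by Gaussian local encoding in the distributed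
round-robin protocol, over all quantization noise variances. -/
def localRegion (K : ℕ) (h : ℝ) (σX2 : ℝ≥0) : Set (RDLTuple K) :=
  {t | ∃ σQ2 : ℝ≥0, 0 < σQ2 ∧
    (∀ k, localRate K h σX2 σQ2 k ≤ t.R k) ∧
    (∀ k, distortion h σX2 σQ2 (localMsg h) k ≤ t.D k) ∧
    (∀ p, leakage h σX2 σQ2 (localMsg h) p.1.1 p.1.2 ≤ ENNReal.ofReal (t.L p))}

/-- The rate-distortion-leakage tuples achieved by Gaussian progressive encoding in the
distributed round-robin protocol, over all quantization noise variances and all real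
coefficients `a_{k,l}`. -/
def progRegion (K : ℕ) (h : ℝ) (σX2 : ℝ≥0) : Set (RDLTuple K) :=
  {t | ∃ σQ2 : ℝ≥0, 0 < σQ2 ∧ ∃ a : Fin K → Fin K → ℝ,
    (∀ k, progRate K h σX2 σQ2 a k ≤ t.R k) ∧
    (∀ k, distortion h σX2 σQ2 (progMsg h a) k ≤ t.D k) ∧
    (∀ p, leakage h σX2 σQ2 (progMsg h a) p.1.1 p.1.2 ≤ ENNReal.ofReal (t.L p))}

/-- `α = E[Y_l ^ 2]`. -/
def alpha (K : ℕ) (h σX2 : ℝ) : ℝ := σX2 * (1 + h * ((K : ℝ) - 1)) + 1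

/-- `β = E[Y_l Y_k]` for `l ≠ k`. -/
def beta (K : ℕ) (h σX2 : ℝ) : ℝ := σX2 * (2 * Real.sqrt h + h * ((K : ℝ) - 2))

/-- `f₁(K, c) = α + (K - 2) β - (K - 1) c`. -/
def f1 (K : ℕ) (h σX2 c : ℝ) : ℝ :=
  alpha K h σX2 + ((K : ℝ) - 2) * beta K h σX2 - ((K : ℝ) - 1) * c

/-- `c₅ = (β - √h σX2)² / (α - σX2 + σQ2) + h σX2`. -/
def c5 (K : ℕ) (h σX2 σQ2 : ℝ) : ℝ :=
  (beta K h σX2 - Real.sqrt h * σX2) ^ 2 / (alpha K h σX2 - σX2 + σQ2) + h * σX2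

end MultiAgent

end

/-!
All the random variables are linear functionals of the Gaussian sample `(X, Z, Q)`, so that two of
them are independent as soon as they are uncorrelated (`indepFun_lin`). Every mutual information in
the theorem has a scalar first argument `A`, and `A = G + E`, where the estimate `G` is a function
of the observations `B` and the error `E` is Gaussian and independent of `B`. The joint law of
`(A, B)` then has an explicit density with respect to the product of the marginals, and
`I(A; B) = ½ log (Var A / Var E)` (`mutualInfo_gaussian_channel`). Only the error variances have to
be found, and only the σ-algebra generated by `B` matters (`mutualInfo_of_estimate`).

Progressive encoding adds to `U_k` a function of the earlier broadcasts. Hence the broadcasts of an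
initial segment of the agents generate the same σ-algebra in both schemes
(`comap_observation_progMsg`). This settles the distortions and the leakages. For the rates, the
error of predicting `Ũ_k` from the past is that of predicting `U_k`; only `Var Ũ_k` depends on the
scheme, and it cancels in the difference of the two mutual informations.

The error variances come from solving the normal equations by symmetry. From `Y_l` and `m` messages
of agents other than `l` and `k`, the error variance of `U_k` is `predError m`, which decreases
with `m`. The message `U_l` is useless to agent `l`, so an agent that has already spoken has one
useful message less than one that has not, and it determines the rate (`progRate_eq`). For the
leakage, the solution of the normal equations for `X_k` is `exists_stateEstimate`, and its error
variance is brought into closed form by a determinant identity (`stateEstimate_variance_mul`).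
-/

/-! ### Mutual information of a Gaussian signal in independent Gaussian noise -/

section GaussianChannel

variable {Ω β : Type*} [MeasurableSpace Ω] [MeasurableSpace β] {P : Measure Ω}

theorem log_gaussianPDFReal_zero {v : ℝ≥0} (hv : v ≠ 0) (x : ℝ) :
    Real.log (gaussianPDFReal 0 v x)
      = -(Real.log (2 * Real.pi) + Real.log v) / 2 - x ^ 2 / (2 * v) := by
  have hv' : (0 : ℝ) < v := by positivity
  have hpi := Real.pi_pos
  rw [gaussianPDFReal, Real.log_mul (by positivity) (Real.exp_ne_zero _), Real.log_exp,
    Real.log_inv, Real.log_sqrt (by positivity), Real.log_mul (by positivity) hv'.ne', sub_zero]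
  ring

/-- If `A = g(B) + E` with Gaussian noise `E` independent of `B`, and `A` is itself Gaussian, then
the joint law of `(A, B)` has an explicit density with respect to the product of the marginals. -/
theorem map_prodMk_eq_withDensity [IsProbabilityMeasure P] {A E : Ω → ℝ} {B : Ω → β} {g : β → ℝ}
    (hg : Measurable g) (hE : Measurable E) (hB : Measurable B)
    (hA : ∀ ω, A ω = g (B ω) + E ω) (hind : IndepFun E B P)
    {v s : ℝ≥0} (hv : v ≠ 0) (hs : s ≠ 0)
    (hEv : P.map E = gaussianReal 0 v) (hAs : P.map A = gaussianReal 0 s) :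
    P.map (fun ω => (A ω, B ω)) = ((P.map A).prod (P.map B)).withDensity
      (fun x => ENNReal.ofReal (gaussianPDFReal 0 v (x.1 - g x.2) / gaussianPDFReal 0 s x.1)) := by
  have hAm : Measurable A := by
    rw [show A = fun ω => g (B ω) + E ω from funext hA]; fun_prop
  have hBprob : IsProbabilityMeasure (P.map B) := Measure.isProbabilityMeasure_map hB.aemeasurable
  have hfm : Measurable (fun x : ℝ × β =>
      ENNReal.ofReal (gaussianPDFReal 0 v (x.1 - g x.2) / gaussianPDFReal 0 s x.1)) := by
    have h1 := measurable_gaussianPDFReal 0 v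
    have h2 := measurable_gaussianPDFReal 0 s
    fun_prop
  refine Measure.ext_of_lintegral _ fun F hF => ?_
  have hF1 : ∀ b, Measurable fun a => F (a, b) := fun b => hF.comp measurable_prodMk_right
  rw [lintegral_withDensity_eq_lintegral_mul _ hfm hF, lintegral_map hF (by fun_prop),
    lintegral_prod_symm' _ (by fun_prop)]
  have h1 : ∫⁻ ω, F (A ω, B ω) ∂P = ∫⁻ x, F (g x.2 + x.1, x.2) ∂((P.map E).prod (P.map B)) := by
    rw [← (indepFun_iff_map_prod_eq_prod_map_map hE.aemeasurable hB.aemeasurable).1 hind,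
      lintegral_map (by fun_prop) (by fun_prop)]
    simp only [hA]
  rw [h1, lintegral_prod_symm' _ (by fun_prop)]
  refine lintegral_congr fun b => ?_
  have h2 := measurable_gaussianPDF 0 v
  have h3 := measurable_gaussianPDF 0 s
  rw [hEv, hAs, gaussianReal_of_var_ne_zero _ hv, gaussianReal_of_var_ne_zero _ hs,
    lintegral_withDensity_eq_lintegral_mul _ (by fun_prop) (by fun_prop),
    lintegral_withDensity_eq_lintegral_mul _ (by fun_prop) (by fun_prop),
    ← lintegral_sub_right_eq_self _ (g b)]
  refine lintegral_congr fun a => ?_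
  simp only [Pi.mul_apply, add_sub_cancel]
  rw [← mul_assoc]
  congr 1
  have := gaussianPDFReal_pos 0 s a hs
  rw [gaussianPDF, gaussianPDF, ← ENNReal.ofReal_mul this.le, mul_div_cancel₀ _ this.ne']

/-- The Kullback-Leibler divergence behind the mutual information of a Gaussian channel
`A = g(B) + E`: it is finite and equal to `½ log (Var A / Var E)`. The input `B` need not be
Gaussian. -/
theorem klDiv_gaussian_channel [IsProbabilityMeasure P] {A E : Ω → ℝ} {B : Ω → β} {g : β → ℝ}
    (hg : Measurable g) (hE : Measurable E) (hB : Measurable B)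
    (hA : ∀ ω, A ω = g (B ω) + E ω) (hind : IndepFun E B P)
    {v s : ℝ≥0} (hv : v ≠ 0) (hs : s ≠ 0)
    (hEv : P.map E = gaussianReal 0 v) (hAs : P.map A = gaussianReal 0 s) :
    klDiv (P.map (fun ω => (A ω, B ω))) ((P.map A).prod (P.map B)) ≠ ∞ ∧
    (klDiv (P.map (fun ω => (A ω, B ω))) ((P.map A).prod (P.map B))).toReal
      = 1 / 2 * Real.log (s / v) := by
  have hAm : Measurable A := by
    rw [show A = fun ω => g (B ω) + E ω from funext hA]; fun_prop
  have hBprob : IsProbabilityMeasure (P.map B) := Measure.isProbabilityMeasure_map hB.aemeasurable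
  have hAprob : IsProbabilityMeasure (P.map A) := Measure.isProbabilityMeasure_map hAm.aemeasurable
  have hABm : Measurable (fun ω => (A ω, B ω)) := by fun_prop
  have hABprob : IsProbabilityMeasure (P.map (fun ω => (A ω, B ω))) :=
    Measure.isProbabilityMeasure_map hABm.aemeasurable
  have hfm : Measurable (fun x : ℝ × β =>
      ENNReal.ofReal (gaussianPDFReal 0 v (x.1 - g x.2) / gaussianPDFReal 0 s x.1)) := by
    have h1 := measurable_gaussianPDFReal 0 v
    have h2 := measurable_gaussianPDFReal 0 s
    fun_prop
  have hd := map_prodMk_eq_withDensity hg hE hB hA hind hv hs hEv hAs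
  have hac : P.map (fun ω => (A ω, B ω)) ≪ (P.map A).prod (P.map B) := by
    rw [hd]; exact withDensity_absolutelyContinuous _ _
  -- the logarithm of the density, as a function on the sample space
  set ℓ : Ω → ℝ := fun ω =>
    1 / 2 * Real.log (s / v) + (1 / (2 * s) * (A ω) ^ 2 - 1 / (2 * v) * (E ω) ^ 2) with hℓ
  have hllr : (fun ω => llr (P.map (fun ω => (A ω, B ω))) ((P.map A).prod (P.map B)) (A ω, B ω))
      =ᵐ[P] ℓ := by
    have h1 := hac.ae_le (Measure.rnDeriv_withDensity ((P.map A).prod (P.map B)) hfm)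
    rw [← hd] at h1
    filter_upwards [ae_of_ae_map hABm.aemeasurable h1] with ω h
    have hp1 := gaussianPDFReal_pos 0 v (E ω) hv
    have hp2 := gaussianPDFReal_pos 0 s (A ω) hs
    have hEA : A ω - g (B ω) = E ω := by rw [hA ω]; ring
    have hv' : (0 : ℝ) < v := by positivity
    have hs' : (0 : ℝ) < s := by positivity
    rw [llr, h, hEA, ENNReal.toReal_ofReal (by positivity), Real.log_div hp1.ne' hp2.ne',
      log_gaussianPDFReal_zero hv, log_gaussianPDFReal_zero hs, hℓ]
    simp only
    rw [Real.log_div hs'.ne' hv'.ne']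
    ring
  have hsq : ∀ {X : Ω → ℝ} {w : ℝ≥0}, Measurable X → P.map X = gaussianReal 0 w →
      Integrable (fun ω => X ω ^ 2) P ∧ ∫ ω, X ω ^ 2 ∂P = w := by
    intro X w hX hw
    have hm : MemLp X 2 P := by
      have := memLp_id_gaussianReal' (μ := 0) (v := w) 2 (by simp)
      rw [← hw, memLp_map_measure_iff (by fun_prop) hX.aemeasurable] at this
      exact this
    refine ⟨hm.integrable_sq, ?_⟩
    have := variance_fun_id_gaussianReal (μ := 0) (v := w)
    rw [variance_eq_integral (by fun_prop)] at this
    simp only [integral_id_gaussianReal, sub_zero] at this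
    rw [← hw, integral_map hX.aemeasurable (by fun_prop)] at this
    exact this
  obtain ⟨hAi, hAe⟩ := hsq hAm hAs
  obtain ⟨hEi, hEe⟩ := hsq hE hEv
  have hAi' : Integrable (fun ω => 1 / (2 * (s : ℝ)) * (A ω) ^ 2) P := hAi.const_mul _
  have hEi' : Integrable (fun ω => 1 / (2 * (v : ℝ)) * (E ω) ^ 2) P := hEi.const_mul _
  have hAE : Integrable
      (fun ω => 1 / (2 * (s : ℝ)) * (A ω) ^ 2 - 1 / (2 * (v : ℝ)) * (E ω) ^ 2) P := hAi'.sub hEi'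
  have hℓi : Integrable ℓ P := (integrable_const _).add hAE
  have hllrm : AEStronglyMeasurable (llr (P.map (fun ω => (A ω, B ω))) ((P.map A).prod (P.map B)))
      (P.map (fun ω => (A ω, B ω))) := (stronglyMeasurable_llr _ _).aestronglyMeasurable
  have hint : Integrable (llr (P.map (fun ω => (A ω, B ω))) ((P.map A).prod (P.map B)))
      (P.map (fun ω => (A ω, B ω))) := by
    rw [integrable_map_measure hllrm hABm.aemeasurable]
    exact hℓi.congr hllr.symm
  refine ⟨klDiv_ne_top hac hint, ?_⟩
  rw [toReal_klDiv_of_measure_eq hac (by simp), integral_map hABm.aemeasurable hllrm,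
    integral_congr_ae hllr, integral_add (integrable_const _) hAE,
    integral_sub hAi' hEi', integral_const_mul (1 / (2 * (s : ℝ))),
    integral_const_mul (1 / (2 * (v : ℝ))), hAe, hEe]
  have hv' : (v : ℝ) ≠ 0 := by simpa using hv
  have hs' : (s : ℝ) ≠ 0 := by simpa using hs
  simp only [integral_const, probReal_univ, one_smul]
  field_simp
  ring

/-- Mutual information of a Gaussian channel `A = G + E`, where the signal `G` is a function of `B`
and the Gaussian noise `E` is independent of `B`. The signal has variance `Var A - Var E`, so `A`
is nondegenerate as soon as `E` is. -/
theorem mutualInfo_gaussian_channel [IsProbabilityMeasure P] {A G E : Ω → ℝ} {B : Ω → β}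
    (hB : Measurable B) (hE : Measurable E)
    (hG : Measurable[MeasurableSpace.comap B inferInstance] G) (hA : ∀ ω, A ω = G ω + E ω)
    (hind : IndepFun E B P) {v s : ℝ} (hv : 0 < v)
    (hEv : P.map E = gaussianReal 0 v.toNNReal) (hAs : P.map A = gaussianReal 0 s.toNNReal) :
    0 < s ∧ mutualInfo P A B ≠ ∞ ∧ (mutualInfo P A B).toReal = 1 / 2 * Real.logb 2 (s / v) := by
  obtain ⟨g, hg, rfl⟩ := hG.exists_eq_measurable_comp
  have hAm : Measurable A := by
    rw [show A = fun ω => g (B ω) + E ω from funext hA]; fun_prop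
  have hmem : ∀ {X : Ω → ℝ} {w : ℝ≥0}, Measurable X → P.map X = gaussianReal 0 w →
      MemLp X 2 P ∧ Var[X; P] = w := by
    intro X w hX hw
    constructor
    · have := memLp_id_gaussianReal' (μ := 0) (v := w) 2 (by simp)
      rw [← hw, memLp_map_measure_iff (by fun_prop) hX.aemeasurable] at this
      exact this
    · have := variance_id_gaussianReal (μ := 0) (v := w)
      rw [← hw, variance_map (by fun_prop) hX.aemeasurable] at this
      exact this
  have hs : 0 < s := by
    obtain ⟨mA, vA⟩ := hmem hAm hAs
    obtain ⟨mE, vE⟩ := hmem hE hEv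
    have hGE : g ∘ B = A - E := by ext ω; simp [hA]
    have mG : MemLp (g ∘ B) 2 P := hGE ▸ mA.sub mE
    have hi : IndepFun (g ∘ B) E P := (hind.comp measurable_id hg).symm
    have hvar := hi.variance_add mG mE
    rw [show g ∘ B + E = A by ext ω; simp [hA], vA, vE] at hvar
    have := variance_nonneg (g ∘ B) P
    rw [Real.coe_toNNReal v hv.le] at hvar
    by_contra hcon
    rw [Real.toNNReal_of_nonpos (not_lt.1 hcon)] at hvar
    simp only [NNReal.coe_zero] at hvar
    linarith
  obtain ⟨h1, h2⟩ := klDiv_gaussian_channel hg hE hB hA hind (by simpa using hv)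
    (by simpa using hs) hEv hAs
  have hl2 : 0 < Real.log 2 := Real.log_pos (by norm_num)
  refine ⟨hs, ENNReal.div_ne_top h1 (by simpa using hl2), ?_⟩
  rw [mutualInfo, ENNReal.toReal_div, h2, ENNReal.toReal_ofReal hl2.le, Real.logb,
    Real.coe_toNNReal _ hs.le, Real.coe_toNNReal _ hv.le]
  ring

end GaussianChannel

namespace MultiAgent

/-! ### Linear functionals of the Gaussian sample -/

variable {K : ℕ}

theorem isGaussian_pi_gaussianReal (v : ℝ≥0) :
    IsGaussian (Measure.pi fun _ : Fin K => gaussianReal 0 v) := by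
  have h : HasGaussianLaw (fun ω : Fin K → ℝ => fun i => ω i)
      (Measure.pi fun _ : Fin K => gaussianReal 0 v) := by
    refine iIndepFun.hasGaussianLaw (X := fun i (ω : Fin K → ℝ) => ω i) (fun i => ⟨?_⟩) ?_
    · rw [show (fun ω : Fin K → ℝ => ω i) = Function.eval i from rfl,
        (measurePreserving_eval (fun _ : Fin K => gaussianReal 0 v) i).map_eq]
      infer_instance
    · exact iIndepFun_pi (X := fun _ x => x) (fun i => by fun_prop)
  have := h.isGaussian_map
  simpa using this

instance isGaussian_law (σX2 σQ2 : ℝ≥0) : IsGaussian (law K σX2 σQ2) := by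
  have := isGaussian_pi_gaussianReal (K := K) σX2
  have := isGaussian_pi_gaussianReal (K := K) σQ2
  have := isGaussian_pi_gaussianReal (K := K) 1
  unfold law
  infer_instance

/-- The linear functional of the sample with coefficient vector `c`: the vector lists the
coefficients of the states, the measurement noises and the quantization noises. -/
noncomputable def lin : Sample K →ₗ[ℝ] Sample K →L[ℝ] ℝ :=
  LinearMap.toContinuousLinearMap.toLinearMap ∘ₗ
    LinearMap.mk₂ ℝ (fun c ω : Sample K => c.1 ⬝ᵥ ω.1 + (c.2.1 ⬝ᵥ ω.2.1 + c.2.2 ⬝ᵥ ω.2.2))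
    (by intros; simp [add_dotProduct]; ring) (by intros; simp [smul_dotProduct]; ring)
    (by intros; simp [dotProduct_add]; ring) (by intros; simp [dotProduct_smul]; ring)

theorem lin_apply (c ω : Sample K) :
    lin c ω = c.1 ⬝ᵥ ω.1 + (c.2.1 ⬝ᵥ ω.2.1 + c.2.2 ⬝ᵥ ω.2.2) := rfl

/-- The covariance of two linear functionals, as a bilinear form on coefficient vectors. -/
noncomputable def covForm (σX2 σQ2 : ℝ) : LinearMap.BilinForm ℝ (Sample K) :=
  LinearMap.mk₂ ℝ (fun c d : Sample K =>
      σX2 * (c.1 ⬝ᵥ d.1) + (c.2.1 ⬝ᵥ d.2.1 + σQ2 * (c.2.2 ⬝ᵥ d.2.2)))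
    (by intros; simp [add_dotProduct]; ring) (by intros; simp [smul_dotProduct]; ring)
    (by intros; simp [dotProduct_add]; ring) (by intros; simp [dotProduct_smul]; ring)

theorem covForm_apply (σX2 σQ2 : ℝ) (c d : Sample K) :
    covForm σX2 σQ2 c d = σX2 * (c.1 ⬝ᵥ d.1) + (c.2.1 ⬝ᵥ d.2.1 + σQ2 * (c.2.2 ⬝ᵥ d.2.2)) := rfl

theorem covForm_comm (σX2 σQ2 : ℝ) (c d : Sample K) :
    covForm σX2 σQ2 c d = covForm σX2 σQ2 d c := by
  simp only [covForm_apply, dotProduct_comm]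

theorem covForm_self_nonneg (σX2 σQ2 : ℝ≥0) (c : Sample K) :
    0 ≤ covForm (σX2 : ℝ) (σQ2 : ℝ) c c := by
  have h (u : Fin K → ℝ) : 0 ≤ u ⬝ᵥ u := Finset.sum_nonneg fun i _ => mul_self_nonneg (u i)
  have h1 := h c.1
  have h2 := h c.2.1
  have h3 := h c.2.2
  rw [covForm_apply]
  positivity

/-- A functional of variance zero does not involve the states or the measurement noises. It may
involve the quantization noises, whose variance is allowed to vanish. -/
theorem fst_snd_fst_eq_zero_of_covForm_self_eq_zero {σX2 σQ2 : ℝ≥0} (hσ : 0 < σX2) {c : Sample K}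
    (hc : covForm (σX2 : ℝ) (σQ2 : ℝ) c c = 0) : c.1 = 0 ∧ c.2.1 = 0 := by
  have h (u : Fin K → ℝ) : 0 ≤ u ⬝ᵥ u := Finset.sum_nonneg fun i _ => mul_self_nonneg (u i)
  have h1 := h c.1
  have h2 := h c.2.1
  have h3 := mul_nonneg σQ2.coe_nonneg (h c.2.2)
  have hσ' : (0 : ℝ) < σX2 := hσ
  have h4 := mul_nonneg hσ'.le h1
  rw [covForm_apply] at hc
  refine ⟨dotProduct_self_eq_zero.1 ?_, dotProduct_self_eq_zero.1 (by linarith)⟩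
  exact (mul_eq_zero.1 (show (σX2 : ℝ) * (c.1 ⬝ᵥ c.1) = 0 by linarith)).resolve_left hσ'.ne'

theorem memLp_eval_pi_gaussianReal (v : ℝ≥0) (i : Fin K) :
    MemLp (fun x : Fin K → ℝ => x i) 2 (Measure.pi fun _ : Fin K => gaussianReal 0 v) :=
  have h := measurePreserving_eval (fun _ : Fin K => gaussianReal 0 v) i
  (memLp_id_gaussianReal' (μ := 0) (v := v) 2 (by simp)).comp_measurePreserving h

theorem memLp_dotProduct_pi_gaussianReal (v : ℝ≥0) (u : Fin K → ℝ) :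
    MemLp (fun x : Fin K → ℝ => u ⬝ᵥ x) 2 (Measure.pi fun _ : Fin K => gaussianReal 0 v) :=
  memLp_finsetSum _ fun i _ => (memLp_eval_pi_gaussianReal v i).const_mul (u i)

theorem covariance_dotProduct_pi_gaussianReal (v : ℝ≥0) (u w : Fin K → ℝ) :
    cov[fun x : Fin K → ℝ => u ⬝ᵥ x, fun x => w ⬝ᵥ x;
      Measure.pi fun _ : Fin K => gaussianReal 0 v] = v * (u ⬝ᵥ w) := by
  have hind : iIndepFun (fun (i : Fin K) (x : Fin K → ℝ) => x i)
      (Measure.pi fun _ : Fin K => gaussianReal 0 v) :=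
    iIndepFun_pi (X := fun _ x => x) (fun i => by fun_prop)
  have hm := memLp_eval_pi_gaussianReal (K := K) v
  have hcov (i j : Fin K) : cov[fun x : Fin K → ℝ => x i, fun x => x j;
      Measure.pi fun _ : Fin K => gaussianReal 0 v] = if i = j then (v : ℝ) else 0 := by
    split_ifs with hij
    · subst hij
      rw [covariance_self (measurable_pi_apply i).aemeasurable]
      have h := measurePreserving_eval (fun _ : Fin K => gaussianReal 0 v) i
      have h2 := variance_map (X := id) (μ := Measure.pi fun _ : Fin K => gaussianReal 0 v)
        (Y := Function.eval i) (by fun_prop) (measurable_pi_apply i).aemeasurable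
      rw [h.map_eq, variance_id_gaussianReal] at h2
      exact h2.symm
    · exact (hind.indepFun hij).covariance_eq_zero (hm i) (hm j)
  simp only [dotProduct]
  rw [covariance_fun_sum_fun_sum (fun i => (hm i).const_mul _) (fun i => (hm i).const_mul _)]
  simp only [covariance_const_mul_left, covariance_const_mul_right, hcov, Finset.mul_sum]
  refine Finset.sum_congr rfl fun i _ => ?_
  simp
  ring

/-- Covariances of functions on a product space split along the two factors. -/
theorem covariance_add_prod {Ω Ω' : Type*} [MeasurableSpace Ω] [MeasurableSpace Ω']
    {μ : Measure Ω} {ν : Measure Ω'} [IsProbabilityMeasure μ] [IsProbabilityMeasure ν]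
    {X X' : Ω → ℝ} {Y Y' : Ω' → ℝ} (hX : MemLp X 2 μ) (hX' : MemLp X' 2 μ)
    (hY : MemLp Y 2 ν) (hY' : MemLp Y' 2 ν) :
    cov[fun p => X p.1 + Y p.2, fun p => X' p.1 + Y' p.2; μ.prod ν]
      = cov[X, X'; μ] + cov[Y, Y'; ν] := by
  have h1 : MemLp (fun p : Ω × Ω' => X p.1) 2 (μ.prod ν) := hX.comp_fst ν
  have h1' : MemLp (fun p : Ω × Ω' => X' p.1) 2 (μ.prod ν) := hX'.comp_fst ν
  have h2 : MemLp (fun p : Ω × Ω' => Y p.2) 2 (μ.prod ν) := hY.comp_snd μ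
  have h2' : MemLp (fun p : Ω × Ω' => Y' p.2) 2 (μ.prod ν) := hY'.comp_snd μ
  have e1 : cov[fun p => X p.1, fun p => X' p.1; μ.prod ν] = cov[X, X'; μ] := by
    have := covariance_map_fun (Z := Prod.fst) (μ := μ.prod ν) (X := X) (Y := X')
      (by simpa using hX.aestronglyMeasurable) (by simpa using hX'.aestronglyMeasurable)
      (by fun_prop)
    simpa using this.symm
  have e2 : cov[fun p => Y p.2, fun p => Y' p.2; μ.prod ν] = cov[Y, Y'; ν] := by
    have := covariance_map_fun (Z := Prod.snd) (μ := μ.prod ν) (X := Y) (Y := Y')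
      (by simpa using hY.aestronglyMeasurable) (by simpa using hY'.aestronglyMeasurable)
      (by fun_prop)
    simpa using this.symm
  have l1 := covariance_add_left h1 h2 (h1'.add h2')
  rw [covariance_add_right h1 h1' h2', covariance_add_right h2 h1' h2',
    covariance_fst_snd_prod hX hY', covariance_comm (fun p : Ω × Ω' => Y p.2),
    covariance_fst_snd_prod hX' hY, e1, e2] at l1
  simpa using! l1

theorem covariance_lin (σX2 σQ2 : ℝ≥0) (c d : Sample K) :
    cov[fun ω => lin c ω, fun ω => lin d ω; law K σX2 σQ2] = covForm σX2 σQ2 c d := by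
  have m := fun v u => memLp_dotProduct_pi_gaussianReal (K := K) v u
  simp only [lin_apply, law]
  rw [covariance_add_prod (X := fun x => c.1 ⬝ᵥ x) (X' := fun x => d.1 ⬝ᵥ x)
      (Y := fun y : (Fin K → ℝ) × (Fin K → ℝ) => c.2.1 ⬝ᵥ y.1 + c.2.2 ⬝ᵥ y.2)
      (Y' := fun y : (Fin K → ℝ) × (Fin K → ℝ) => d.2.1 ⬝ᵥ y.1 + d.2.2 ⬝ᵥ y.2)
      (m _ _) (m _ _) (((m _ _).comp_fst _).add ((m _ _).comp_snd _))
      (((m _ _).comp_fst _).add ((m _ _).comp_snd _)),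
    covariance_add_prod (X := fun x => c.2.1 ⬝ᵥ x) (X' := fun x => d.2.1 ⬝ᵥ x)
      (Y := fun x => c.2.2 ⬝ᵥ x) (Y' := fun x => d.2.2 ⬝ᵥ x) (m _ _) (m _ _) (m _ _) (m _ _),
    covariance_dotProduct_pi_gaussianReal, covariance_dotProduct_pi_gaussianReal,
    covariance_dotProduct_pi_gaussianReal, covForm_apply]
  simp

theorem integral_lin (σX2 σQ2 : ℝ≥0) (c : Sample K) : ∫ ω, lin c ω ∂(law K σX2 σQ2) = 0 := by
  -- the law is invariant under the reflection of all coordinates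
  have hpi (v : ℝ≥0) : MeasurePreserving (fun x : Fin K → ℝ => -x)
      (Measure.pi fun _ : Fin K => gaussianReal 0 v)
      (Measure.pi fun _ : Fin K => gaussianReal 0 v) :=
    measurePreserving_pi _ _ (f := fun _ x => -x) fun _ =>
      ⟨by fun_prop, by rw [gaussianReal_map_neg, neg_zero]⟩
  have hlaw : MeasurePreserving (fun ω : Sample K => -ω) (law K σX2 σQ2) (law K σX2 σQ2) :=
    (hpi σX2).prod ((hpi 1).prod (hpi σQ2))
  have h := hlaw.integral_comp (MeasurableEquiv.neg (Sample K)).measurableEmbedding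
    (fun ω => lin c ω)
  simp only [map_neg, integral_neg] at h
  linarith

theorem map_lin (σX2 σQ2 : ℝ≥0) (c : Sample K) :
    (law K σX2 σQ2).map (fun ω => lin c ω) = gaussianReal 0 (covForm σX2 σQ2 c c).toNNReal := by
  have h : HasGaussianLaw (fun ω => lin c ω) (law K σX2 σQ2) :=
    IsGaussian.hasGaussianLaw_id.map_fun (lin c)
  rw [h.map_eq_gaussianReal, integral_lin, ← covariance_self (by fun_prop), covariance_lin]

/-- Uncorrelated linear functionals are independent. -/
theorem indepFun_lin {ι : Type*} [Finite ι] (σX2 σQ2 : ℝ≥0) (e : Sample K) (d : ι → Sample K)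
    (h : ∀ i, covForm (σX2 : ℝ) (σQ2 : ℝ) e (d i) = 0) :
    IndepFun (fun ω => lin e ω) (fun ω i => lin (d i) ω) (law K σX2 σQ2) := by
  have := Fintype.ofFinite ι
  have hg : HasGaussianLaw (fun ω => (fun _ : Unit => lin e ω, fun i => lin (d i) ω))
      (law K σX2 σQ2) :=
    IsGaussian.hasGaussianLaw_id.map_fun
      ((ContinuousLinearMap.pi fun _ : Unit => lin e).prod
        (ContinuousLinearMap.pi fun i => lin (d i)))
  have hi := hg.indepFun_of_covariance_eval fun _ j => by
    rw [covariance_lin, h j]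
  exact hi.comp (φ := fun x : Unit → ℝ => x ()) (by exact measurable_pi_apply ()) measurable_id

/-! ### Coefficient vectors of the states, measurements and messages -/

/-- The coefficient vector of the state `X_k`. -/
def stateVec (k : Fin K) : Sample K := (Pi.single k 1, 0, 0)

/-- The coefficient vector of the quantization noise `Q_k`. -/
def quantVec (k : Fin K) : Sample K := (0, 0, Pi.single k 1)

/-- The coefficient vector of the measurement `Y_k`: the coefficient of `X_k` is `1`, written as
`√h + (1 - √h)`, and that of every other state is `√h`. -/
noncomputable def measVec (h : ℝ) (k : Fin K) : Sample K :=
  (Real.sqrt h • 1 + (1 - Real.sqrt h) • Pi.single k 1, Pi.single k 1, 0)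

/-- The coefficient vector of the local message `U_k`. -/
noncomputable def msgVec (h : ℝ) (k : Fin K) : Sample K := measVec h k + quantVec k

theorem lin_stateVec (k : Fin K) (ω : Sample K) : lin (stateVec k) ω = state k ω := by
  simp [lin_apply, stateVec, state]

theorem lin_quantVec (k : Fin K) (ω : Sample K) : lin (quantVec k) ω = ω.2.2 k := by
  simp [lin_apply, quantVec]

theorem lin_measVec (h : ℝ) (k : Fin K) (ω : Sample K) : lin (measVec h k) ω = meas h k ω := by
  rw [meas, ← Finset.mul_sum, Finset.sum_erase_eq_sub (Finset.mem_univ k)]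
  simp [lin_apply, measVec, add_dotProduct, smul_dotProduct, one_dotProduct]
  ring

theorem lin_msgVec (h : ℝ) (k : Fin K) (ω : Sample K) :
    lin (msgVec h k) ω = localMsg h k ω := by
  rw [msgVec, map_add, add_apply, lin_measVec, lin_quantVec, localMsg]

section Covariances

variable {h σX2 σQ2 : ℝ}

theorem covForm_stateVec_stateVec (k : Fin K) :
    covForm σX2 σQ2 (stateVec k) (stateVec k) = σX2 := by
  simp [covForm_apply, stateVec]

theorem covForm_quantVec_quantVec (k j : Fin K) :
    covForm σX2 σQ2 (quantVec k) (quantVec j) = if k = j then σQ2 else 0 := by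
  simp [covForm_apply, quantVec, Pi.single_apply, eq_comm]

theorem covForm_stateVec_quantVec (k j : Fin K) :
    covForm σX2 σQ2 (stateVec k) (quantVec j) = 0 := by
  simp [covForm_apply, stateVec, quantVec]

theorem covForm_measVec_quantVec (k j : Fin K) :
    covForm σX2 σQ2 (measVec h k) (quantVec j) = 0 := by
  simp [covForm_apply, measVec, quantVec]

theorem covForm_quantVec_measVec (k j : Fin K) :
    covForm σX2 σQ2 (quantVec k) (measVec h j) = 0 := by
  rw [covForm_comm, covForm_measVec_quantVec]

theorem covForm_stateVec_measVec (k j : Fin K) :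
    covForm σX2 σQ2 (stateVec k) (measVec h j)
      = Real.sqrt h * σX2 + if k = j then σX2 - Real.sqrt h * σX2 else 0 := by
  by_cases hkj : k = j
  · simp [covForm_apply, stateVec, measVec, hkj]
  · simp [covForm_apply, stateVec, measVec, hkj]
    ring

theorem covForm_measVec_measVec (hh : 0 ≤ h) (k j : Fin K) :
    covForm σX2 σQ2 (measVec h k) (measVec h j)
      = beta K h σX2 + if k = j then alpha K h σX2 - beta K h σX2 else 0 := by
  have hr := Real.mul_self_sqrt hh
  by_cases hkj : k = j
  · simp [covForm_apply, measVec, hkj, add_dotProduct, smul_dotProduct, dotProduct_add, alpha]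
    left
    linear_combination (K - 1 : ℝ) * hr
  · simp [covForm_apply, measVec, hkj, add_dotProduct, smul_dotProduct, dotProduct_add, beta]
    left
    linear_combination (K - 2 : ℝ) * hr

theorem covForm_stateVec_msgVec (k j : Fin K) :
    covForm σX2 σQ2 (stateVec k) (msgVec h j)
      = Real.sqrt h * σX2 + if k = j then σX2 - Real.sqrt h * σX2 else 0 := by
  rw [msgVec, map_add, covForm_stateVec_measVec, covForm_stateVec_quantVec, add_zero]

theorem covForm_msgVec_measVec (hh : 0 ≤ h) (k j : Fin K) :
    covForm σX2 σQ2 (msgVec h k) (measVec h j)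
      = beta K h σX2 + if k = j then alpha K h σX2 - beta K h σX2 else 0 := by
  rw [msgVec, map_add, LinearMap.add_apply, covForm_measVec_measVec hh, covForm_quantVec_measVec,
    add_zero]

theorem covForm_measVec_msgVec (hh : 0 ≤ h) (k j : Fin K) :
    covForm σX2 σQ2 (measVec h k) (msgVec h j)
      = beta K h σX2 + if k = j then alpha K h σX2 - beta K h σX2 else 0 := by
  rw [msgVec, map_add, covForm_measVec_measVec hh, covForm_measVec_quantVec, add_zero]

theorem covForm_msgVec_msgVec (hh : 0 ≤ h) (k j : Fin K) :
    covForm σX2 σQ2 (msgVec h k) (msgVec h j)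
      = beta K h σX2 + if k = j then alpha K h σX2 - beta K h σX2 + σQ2 else 0 := by
  rw [msgVec, map_add, LinearMap.add_apply, covForm_measVec_msgVec hh, msgVec, map_add,
    covForm_quantVec_measVec, covForm_quantVec_quantVec]
  split_ifs <;> ring

end Covariances

section Parameters

variable {h σX2 : ℝ}

/-- The difference is `σX2 (1 - √h)² + 1`. -/
theorem one_le_alpha_sub_beta (hh : 0 ≤ h) (hσ : 0 ≤ σX2) :
    1 ≤ alpha K h σX2 - beta K h σX2 := by
  have hr := Real.sq_sqrt hh
  have h1 := mul_nonneg hσ (sq_nonneg (1 - Real.sqrt h))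
  have h2 : alpha K h σX2 - beta K h σX2 = σX2 * (1 - Real.sqrt h) ^ 2 + 1 := by
    rw [alpha, beta]; linear_combination (-σX2) * hr
  linarith

theorem beta_nonneg (hK : 2 ≤ K) (hh : 0 ≤ h) (hσ : 0 ≤ σX2) : 0 ≤ beta K h σX2 := by
  have : (2 : ℝ) ≤ K := by exact_mod_cast hK
  have : (0 : ℝ) ≤ K - 2 := by linarith
  unfold beta
  positivity

theorem one_le_alpha_sub_variance (hK : 2 ≤ K) (hh : 0 ≤ h) (hσ : 0 ≤ σX2) :
    1 ≤ alpha K h σX2 - σX2 := by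
  have : (2 : ℝ) ≤ K := by exact_mod_cast hK
  have : (0 : ℝ) ≤ K - 1 := by linarith
  have : 0 ≤ σX2 * (h * (K - 1)) := by positivity
  unfold alpha
  linarith

end Parameters

/-! ### The information carried by local and progressive broadcasts -/

/-- The measurement of agent `l` together with the broadcasts of the agents in `S`. For
`S = Set.Iio k` this is `measAndPast` by definition. -/
noncomputable def observation (h : ℝ) (U : Fin K → Sample K → ℝ) (l : Fin K) (S : Set (Fin K))
    (ω : Sample K) : ℝ × (S → ℝ) :=
  (meas h l ω, fun j => U j ω)

theorem comap_observation_le_iff {m : MeasurableSpace (Sample K)} {h : ℝ}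
    {U : Fin K → Sample K → ℝ} {l : Fin K} {S : Set (Fin K)} :
    MeasurableSpace.comap (observation h U l S) inferInstance ≤ m ↔
      Measurable[m] (meas h l) ∧ ∀ j ∈ S, Measurable[m] (U j) := by
  rw [← measurable_iff_comap_le]
  constructor
  · intro H
    exact ⟨measurable_fst.comp H,
      fun j hj => (measurable_pi_apply (⟨j, hj⟩ : S)).comp (measurable_snd.comp H)⟩
  · rintro ⟨h1, h2⟩
    exact h1.prodMk (measurable_pi_iff.2 fun j => h2 j j.2)

theorem comap_measAndAll {h : ℝ} {U : Fin K → Sample K → ℝ} {l : Fin K} :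
    MeasurableSpace.comap (measAndAll h U l) inferInstance
      = MeasurableSpace.comap (observation h U l Set.univ) inferInstance := by
  have key (m : MeasurableSpace (Sample K)) (h1 : Measurable[m] (meas h l))
      (h2 : ∀ j, Measurable[m] (U j)) : Measurable[m] (measAndAll h U l) :=
    h1.prodMk (measurable_pi_iff.2 h2)
  apply le_antisymm
  · obtain ⟨h1, h2⟩ := comap_observation_le_iff.1
      (le_refl (MeasurableSpace.comap (observation h U l Set.univ) inferInstance))
    exact measurable_iff_comap_le.1 (key _ h1 fun j => h2 j trivial)
  · have H := comap_measurable (m := Prod.instMeasurableSpace) (measAndAll h U l)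
    exact comap_observation_le_iff.2 ⟨measurable_fst.comp H,
      fun j _ => (measurable_pi_apply j).comp (measurable_snd.comp H)⟩

theorem localMsg_eq_progMsg_sub (h : ℝ) (a : Fin K → Fin K → ℝ) (k : Fin K) (ω : Sample K) :
    localMsg h k ω = progMsg h a k ω - ∑ l : Set.Iio k, a k l * progMsg h a l.1 ω := by
  rw [progMsg, localMsg]; ring

theorem progMsg_zero (h : ℝ) : progMsg (K := K) h 0 = localMsg h := by
  ext k ω
  rw [localMsg_eq_progMsg_sub h 0]
  simp

theorem exists_lin_eq_progMsg (h : ℝ) (a : Fin K → Fin K → ℝ) (k : Fin K) :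
    ∃ c : Sample K, ∀ ω, progMsg h a k ω = lin c ω := by
  induction k using WellFoundedLT.induction with
  | _ k ih =>
    choose! c hc using ih
    refine ⟨msgVec h k + ∑ l : Set.Iio k, a k l • c l.1, fun ω => ?_⟩
    have := localMsg_eq_progMsg_sub h a k ω
    simp only [map_add, map_sum, map_smul, add_apply,
      sum_apply, smul_apply, lin_msgVec, smul_eq_mul]
    rw [this, Finset.sum_congr rfl fun l _ => by rw [hc l.1 l.2 ω]]
    ring

theorem measurable_meas (h : ℝ) (k : Fin K) : Measurable (meas h k) := by
  rw [show meas h k = fun ω => lin (measVec h k) ω from funext fun ω => (lin_measVec h k ω).symm]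
  fun_prop

theorem measurable_progMsg (h : ℝ) (a : Fin K → Fin K → ℝ) (k : Fin K) :
    Measurable (progMsg h a k) := by
  obtain ⟨c, hc⟩ := exists_lin_eq_progMsg h a k
  rw [show progMsg h a k = fun ω => lin c ω from funext hc]
  fun_prop

/-- Each round of the progressive scheme adds to `U_k` a function of the past, so that the
progressive broadcasts of an initial segment of agents generate the same σ-algebra as the local
ones. -/
theorem comap_observation_progMsg (h : ℝ) (a : Fin K → Fin K → ℝ) (l : Fin K) {S : Set (Fin K)}
    (hS : IsLowerSet S) :
    MeasurableSpace.comap (observation h (progMsg h a) l S) inferInstance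
      = MeasurableSpace.comap (observation h (localMsg h) l S) inferInstance := by
  apply le_antisymm
  · obtain ⟨h1, h2⟩ := comap_observation_le_iff.1
      (le_refl (MeasurableSpace.comap (observation h (localMsg h) l S) inferInstance))
    refine comap_observation_le_iff.2 ⟨h1, fun j => ?_⟩
    induction j using WellFoundedLT.induction with
    | _ j ih =>
      intro hj
      have e : progMsg h a j
          = fun ω => localMsg h j ω + ∑ l : Set.Iio j, a j l * progMsg h a l.1 ω := by
        ext ω; rw [localMsg_eq_progMsg_sub h a]; ring
      rw [e]
      exact (h2 j hj).add (Finset.measurable_sum _ fun i _ =>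
        (ih i.1 i.2 (hS (le_of_lt i.2) hj)).const_mul _)
  · obtain ⟨h1, h2⟩ := comap_observation_le_iff.1
      (le_refl (MeasurableSpace.comap (observation h (progMsg h a) l S) inferInstance))
    refine comap_observation_le_iff.2 ⟨h1, fun j hj => ?_⟩
    rw [show localMsg h j = _ from funext (localMsg_eq_progMsg_sub h a j)]
    exact (h2 j hj).sub (Finset.measurable_sum _ fun i _ =>
      (h2 i.1 (hS (le_of_lt i.2) hj)).const_mul _)

theorem distortion_progMsg (h : ℝ) (σX2 σQ2 : ℝ≥0) (a : Fin K → Fin K → ℝ) (k : Fin K) :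
    distortion h σX2 σQ2 (progMsg h a) k = distortion h σX2 σQ2 (localMsg h) k := by
  unfold distortion meanCondVar
  rw [comap_measAndAll, comap_measAndAll, comap_observation_progMsg h a k isLowerSet_univ]

/-- Mutual information from a linear estimate. If the error `e` of an estimate of the functional
`c` is uncorrelated with the observations and has positive variance, the mutual information
depends only on the variances of `c` and `e`. It does not matter through which random element `T`
the observations enter, as long as it determines the estimate. -/
theorem mutualInfo_of_estimate {β : Type*} [MeasurableSpace β] {h : ℝ} {σX2 σQ2 : ℝ≥0}
    {l : Fin K} {S : Set (Fin K)} {T : Sample K → β} (hTm : Measurable T)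
    (hT : MeasurableSpace.comap T inferInstance
      ≤ MeasurableSpace.comap (observation h (localMsg h) l S) inferInstance)
    {A : Sample K → ℝ} {c e : Sample K} (hA : ∀ ω, A ω = lin c ω)
    (he : covForm (σX2 : ℝ) (σQ2 : ℝ) e (measVec h l) = 0)
    (heS : ∀ j ∈ S, covForm (σX2 : ℝ) (σQ2 : ℝ) e (msgVec h j) = 0)
    (hpos : 0 < covForm (σX2 : ℝ) (σQ2 : ℝ) e e)
    (hG : Measurable[MeasurableSpace.comap T inferInstance] (fun ω => A ω - lin e ω)) :
    0 < covForm (σX2 : ℝ) (σQ2 : ℝ) c c ∧ mutualInfo (law K σX2 σQ2) A T ≠ ∞ ∧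
      (mutualInfo (law K σX2 σQ2) A T).toReal
        = 1 / 2 * Real.logb 2 (covForm (σX2 : ℝ) (σQ2 : ℝ) c c
            / covForm (σX2 : ℝ) (σQ2 : ℝ) e e) := by
  have hind := indepFun_lin (ι := Option S) σX2 σQ2 e
    (fun i => i.elim (measVec h l) fun j => msgVec h j) (by
      rintro (_ | j)
      · exact he
      · exact heS j j.2)
  have hle : MeasurableSpace.comap (observation h (localMsg h) l S) inferInstance ≤
      MeasurableSpace.comap (fun ω (i : Option S) =>
        lin (i.elim (measVec h l) fun j => msgVec h j) ω) inferInstance := by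
    have H := comap_measurable (m := MeasurableSpace.pi) (fun ω (i : Option S) =>
        lin (i.elim (measVec h l) fun j => msgVec h j) ω)
    refine comap_observation_le_iff.2 ⟨?_, fun j hj => ?_⟩
    · have := (measurable_pi_apply (none : Option S)).comp H
      simpa only [Function.comp_def, Option.elim_none, lin_measVec] using! this
    · have := (measurable_pi_apply (some ⟨j, hj⟩ : Option S)).comp H
      simpa only [Function.comp_def, Option.elim_some, lin_msgVec] using! this
  have hind' : IndepFun (fun ω => lin e ω) T (law K σX2 σQ2) := by
    rw [IndepFun_iff_Indep] at hind ⊢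
    exact indep_of_indep_of_le_right hind (hT.trans hle)
  exact mutualInfo_gaussian_channel hTm (by fun_prop) hG (fun ω => by ring) hind' hpos
    (map_lin σX2 σQ2 e) (by rw [show A = _ from funext hA]; exact map_lin σX2 σQ2 c)

/-! ### Rates -/

/-- The mean square error of the best linear estimate of `U_k` from one measurement `Y_l` of
another agent and the messages `U_j` of `m` further agents. With `p = α - β + σ_Q²` and
`q = β - β² / α` it is `p + p q / (p + m q)`. -/
noncomputable def predError (K : ℕ) (h σX2 σQ2 : ℝ) (m : ℕ) : ℝ :=
  let p := alpha K h σX2 - beta K h σX2 + σQ2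
  let q := beta K h σX2 - beta K h σX2 ^ 2 / alpha K h σX2
  p + p * q / (p + m * q)

section PredError

variable {h σX2 σQ2 : ℝ}

theorem alpha_pos (hK : 2 ≤ K) (hh : 0 ≤ h) (hσ : 0 ≤ σX2) : 0 < alpha K h σX2 := by
  linarith [one_le_alpha_sub_variance hK hh hσ]

theorem beta_sub_sq_div_alpha_nonneg (hK : 2 ≤ K) (hh : 0 ≤ h) (hσ : 0 ≤ σX2) :
    0 ≤ beta K h σX2 - beta K h σX2 ^ 2 / alpha K h σX2 := by
  have hα := alpha_pos hK hh hσ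
  have hβ := beta_nonneg hK hh hσ
  have hαβ := one_le_alpha_sub_beta (K := K) hh hσ
  rw [sub_nonneg, div_le_iff₀ hα, sq]
  gcongr
  linarith

theorem predError_pos (hK : 2 ≤ K) (hh : 0 ≤ h) (hσ : 0 ≤ σX2) (hQ : 0 ≤ σQ2) (m : ℕ) :
    0 < predError K h σX2 σQ2 m := by
  have hq := beta_sub_sq_div_alpha_nonneg hK hh hσ
  have hαβ := one_le_alpha_sub_beta (K := K) hh hσ
  have hp : 0 < alpha K h σX2 - beta K h σX2 + σQ2 := by linarith
  simp only [predError]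
  positivity

theorem predError_antitone (hK : 2 ≤ K) (hh : 0 ≤ h) (hσ : 0 ≤ σX2) (hQ : 0 ≤ σQ2) :
    Antitone (predError K h σX2 σQ2) := by
  intro m n hmn
  have hq := beta_sub_sq_div_alpha_nonneg hK hh hσ
  have hαβ := one_le_alpha_sub_beta (K := K) hh hσ
  have hp : 0 < alpha K h σX2 - beta K h σX2 + σQ2 := by linarith
  simp only [predError]
  gcongr

/-- The estimate of `U_k` behind `predError`: the normal equations have a solution that gives the
same weight `y` to all messages. A message of agent `l` itself is not used, as it is a noisy
version of the available measurement `Y_l`. -/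
theorem exists_prediction (hK : 2 ≤ K) (hh : 0 ≤ h) (hσ : 0 ≤ σX2) (hQ : 0 ≤ σQ2) {l k : Fin K}
    (hlk : l ≠ k) : ∃ (x y : ℝ) (e : Sample K),
      e = msgVec h k - (x • measVec h l + y • ∑ j ∈ (Finset.Iio k).erase l, msgVec h j) ∧
      covForm σX2 σQ2 e (measVec h l) = 0 ∧
      (∀ j ∈ Set.Iio k, covForm σX2 σQ2 e (msgVec h j) = 0) ∧
      covForm σX2 σQ2 e e = predError K h σX2 σQ2 ((Finset.Iio k).erase l).card := by
  set F := (Finset.Iio k).erase l with hF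
  set m : ℝ := (F.card : ℝ) with hm
  have hlF : l ∉ F := Finset.notMem_erase _ _
  have hkF : k ∉ F := fun hk => by simp [hF] at hk
  have hα := alpha_pos hK hh hσ
  have hq := beta_sub_sq_div_alpha_nonneg hK hh hσ
  have hαβ := one_le_alpha_sub_beta (K := K) hh hσ
  have hp : 0 < alpha K h σX2 - beta K h σX2 + σQ2 := by linarith
  have hm0 : 0 ≤ m := by positivity
  simp only [predError]
  rw [← hm]
  set α := alpha K h σX2 with hαd
  set β := beta K h σX2 with hβd
  set q := β - β ^ 2 / α with hqd
  set p := α - β + σQ2 with hpd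
  have hD : 0 < p + m * q := by positivity
  set y := q / (p + m * q) with hy
  set x := β * (1 - m * y) / α with hx
  have hxα : x * α = β * (1 - m * y) := by rw [hx]; field_simp
  have hqα : q * α = β * α - β ^ 2 := by rw [hqd]; field_simp
  have hyD : y * (p + m * q) = q := by rw [hy]; field_simp
  -- the normal equations for the measurement and for the messages
  have e1 : β - (x * α + y * (m * β)) = 0 := by linear_combination -hxα
  have e2 : β - (x * β + y * (p + m * β)) = 0 := by
    refine (mul_eq_zero.1 (?_ : α * _ = 0)).resolve_left hα.ne'
    linear_combination (-β) * hxα - α * hyD - (1 - y * m) * hqα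
  have hmeas (j : Fin K) (hj : j = l) :
      covForm σX2 σQ2 (msgVec h k - (x • measVec h l + y • ∑ j ∈ F, msgVec h j)) (measVec h j)
        = 0 := by
    subst hj
    simp only [map_sub, map_add, map_smul, map_sum, LinearMap.sub_apply, LinearMap.add_apply,
      LinearMap.smul_apply, LinearMap.sum_apply, covForm_msgVec_measVec hh,
      covForm_measVec_measVec hh, smul_eq_mul, Finset.sum_add_distrib, Finset.sum_const,
      nsmul_eq_mul, Finset.sum_ite_eq', hlF, hlk.symm, if_true, if_false]
    linear_combination e1
  have hmsg (j : Fin K) (hj : j ∈ Finset.Iio k) :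
      covForm σX2 σQ2 (msgVec h k - (x • measVec h l + y • ∑ j ∈ F, msgVec h j)) (msgVec h j)
        = 0 := by
    have hkj : k ≠ j := (Finset.mem_Iio.1 hj).ne'
    simp only [map_sub, map_add, map_smul, map_sum, LinearMap.sub_apply, LinearMap.add_apply,
      LinearMap.smul_apply, LinearMap.sum_apply, covForm_msgVec_msgVec hh,
      covForm_measVec_msgVec hh, smul_eq_mul, Finset.sum_add_distrib, Finset.sum_const,
      nsmul_eq_mul, Finset.sum_ite_eq', hkj, if_false]
    by_cases hjl : j = l
    · subst hjl
      simp only [hlF, if_true, if_false]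
      linear_combination e1
    · have hjF : j ∈ F := Finset.mem_erase.2 ⟨hjl, hj⟩
      simp only [hjF, Ne.symm hjl, if_true, if_false]
      linear_combination e2
  refine ⟨x, y, _, rfl, hmeas l rfl, fun j hj => hmsg j (by simpa using hj), ?_⟩
  -- the error is orthogonal to its own estimate, so only its covariance with `U_k` counts
  have hself : covForm σX2 σQ2 (msgVec h k - (x • measVec h l + y • ∑ j ∈ F, msgVec h j))
      (msgVec h k) = β + p - (x * β + y * (m * β)) := by
    simp only [map_sub, map_add, map_smul, map_sum, LinearMap.sub_apply, LinearMap.add_apply,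
      LinearMap.smul_apply, LinearMap.sum_apply, covForm_msgVec_msgVec hh,
      covForm_measVec_msgVec hh, smul_eq_mul, Finset.sum_add_distrib, Finset.sum_const,
      nsmul_eq_mul, Finset.sum_ite_eq', hkF, hlk, if_true, if_false]
    ring
  rw [map_sub, hself, map_add, map_smul, map_smul, map_sum, hmeas l rfl,
    Finset.sum_eq_zero fun j hj => hmsg j (Finset.mem_of_mem_erase hj)]
  have : p * q / (p + m * q) = p * y := by rw [hy]; ring
  rw [this]
  simp only [smul_zero, add_zero, sub_zero]
  linear_combination e2

end PredError

section Rates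

variable {h : ℝ} {σX2 σQ2 : ℝ≥0}

/-- Information about `Ũ_k` at another agent `l`. Since `T` is only assumed to determine `Y_l` and
the past broadcasts, it may be the pair of these or, for the first agent, `Y_l` alone. -/
theorem mutualInfo_progMsg_past (hK : 2 ≤ K) (hh : 0 ≤ h) (a : Fin K → Fin K → ℝ) {l k : Fin K}
    (hlk : l ≠ k) {c : Sample K} (hc : ∀ ω, progMsg h a k ω = lin c ω)
    {β : Type*} [MeasurableSpace β] {T : Sample K → β} (hTm : Measurable T)
    (hT : MeasurableSpace.comap T inferInstance
      ≤ MeasurableSpace.comap (observation h (localMsg h) l (Set.Iio k)) inferInstance)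
    (hY : Measurable[MeasurableSpace.comap T inferInstance] (meas h l))
    (hU : ∀ j < k, Measurable[MeasurableSpace.comap T inferInstance] (progMsg h a j)) :
    0 < covForm (σX2 : ℝ) (σQ2 : ℝ) c c ∧
      mutualInfo (law K σX2 σQ2) (progMsg h a k) T ≠ ∞ ∧
      (mutualInfo (law K σX2 σQ2) (progMsg h a k) T).toReal
        = 1 / 2 * Real.logb 2 (covForm (σX2 : ℝ) (σQ2 : ℝ) c c
            / predError K h σX2 σQ2 ((Finset.Iio k).erase l).card) := by
  obtain ⟨x, y, e, he, h1, h2, h3⟩ :=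
    exists_prediction hK hh σX2.coe_nonneg σQ2.coe_nonneg hlk
  rw [← h3]
  refine mutualInfo_of_estimate hTm hT hc h1 h2
    (h3 ▸ predError_pos hK hh σX2.coe_nonneg σQ2.coe_nonneg _) ?_
  have hloc : ∀ j < k, Measurable[MeasurableSpace.comap T inferInstance] (localMsg h j) := by
    intro j hj
    rw [show localMsg h j = _ from funext (localMsg_eq_progMsg_sub h a j)]
    exact (hU j hj).sub (Finset.measurable_sum _ fun i _ =>
      (hU i.1 (lt_trans i.2 hj)).const_mul _)
  have hG : (fun ω => progMsg h a k ω - lin e ω) = fun ω =>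
      (∑ i : Set.Iio k, a k i * progMsg h a i.1 ω)
        + (x * meas h l ω + y * ∑ j ∈ (Finset.Iio k).erase l, localMsg h j ω) := by
    ext ω
    have := localMsg_eq_progMsg_sub h a k ω
    simp only [he, map_sub, map_add, map_smul, map_sum, sub_apply,
      add_apply, smul_apply, sum_apply, lin_msgVec, lin_measVec, smul_eq_mul]
    rw [this]
    ring
  rw [hG]
  exact (Finset.measurable_sum _ fun i _ => (hU i.1 i.2).const_mul _).add
    ((hY.const_mul _).add ((Finset.measurable_sum _ fun j hj =>
      hloc j (Finset.mem_Iio.1 (Finset.mem_of_mem_erase hj))).const_mul _))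

/-- Given its own measurement and the past, only the quantization noise of `Ũ_k` is unknown. -/
theorem mutualInfo_progMsg_own (hQ : 0 < σQ2) (a : Fin K → Fin K → ℝ) {k : Fin K} {c : Sample K}
    (hc : ∀ ω, progMsg h a k ω = lin c ω)
    {β : Type*} [MeasurableSpace β] {T : Sample K → β} (hTm : Measurable T)
    (hT : MeasurableSpace.comap T inferInstance
      ≤ MeasurableSpace.comap (observation h (localMsg h) k (Set.Iio k)) inferInstance)
    (hY : Measurable[MeasurableSpace.comap T inferInstance] (meas h k))
    (hU : Measurable[MeasurableSpace.comap T inferInstance]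
      (fun ω => ∑ i : Set.Iio k, a k i * progMsg h a i.1 ω)) :
    mutualInfo (law K σX2 σQ2) (progMsg h a k) T ≠ ∞ ∧
      (mutualInfo (law K σX2 σQ2) (progMsg h a k) T).toReal
        = 1 / 2 * Real.logb 2 (covForm (σX2 : ℝ) (σQ2 : ℝ) c c / σQ2) := by
  have h3 : covForm (σX2 : ℝ) (σQ2 : ℝ) (quantVec k) (quantVec k) = σQ2 := by
    rw [covForm_quantVec_quantVec, if_pos rfl]
  have := mutualInfo_of_estimate (e := quantVec k) hTm hT hc (covForm_quantVec_measVec k k)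
    (fun j (hj : j < k) => by
      rw [msgVec, map_add, covForm_quantVec_measVec, covForm_quantVec_quantVec, if_neg hj.ne',
        add_zero])
    (h3.symm ▸ NNReal.coe_pos.2 hQ) (by
      have hG : (fun ω => progMsg h a k ω - lin (quantVec k) ω) = fun ω =>
          (∑ i : Set.Iio k, a k i * progMsg h a i.1 ω) + meas h k ω := by
        ext ω
        have := localMsg_eq_progMsg_sub h a k ω
        rw [localMsg] at this
        rw [lin_quantVec]
        linear_combination -this
      rw [hG]
      exact hU.add hY)
  rw [h3] at this
  exact this.2

theorem measurable_observation_progMsg (a : Fin K → Fin K → ℝ) (l : Fin K) (S : Set (Fin K)) :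
    Measurable (observation h (progMsg h a) l S) :=
  (measurable_meas h l).prodMk (measurable_pi_iff.2 fun j => measurable_progMsg h a j)

/-- The mutual informations between a progressive message and the past. Only the factor
`Var Ũ_k` depends on the coefficients `a`. -/
theorem mutualInfo_progMsg_measAndPast (hK : 2 ≤ K) (hh : 0 ≤ h) (hQ : 0 < σQ2)
    (a : Fin K → Fin K → ℝ) (l k : Fin K) {c : Sample K}
    (hc : ∀ ω, progMsg h a k ω = lin c ω) :
    mutualInfo (law K σX2 σQ2) (progMsg h a k) (measAndPast h (progMsg h a) l k) ≠ ∞ ∧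
      (mutualInfo (law K σX2 σQ2) (progMsg h a k) (measAndPast h (progMsg h a) l k)).toReal
        = 1 / 2 * Real.logb 2 (covForm (σX2 : ℝ) (σQ2 : ℝ) c c
            / if l = k then (σQ2 : ℝ)
              else predError K h σX2 σQ2 ((Finset.Iio k).erase l).card) := by
  have hle := (comap_observation_progMsg h a l (isLowerSet_Iio k)).le
  have hm := measurable_observation_progMsg (h := h) a l (Set.Iio k)
  obtain ⟨h1, h2⟩ := comap_observation_le_iff.1
    (le_refl (MeasurableSpace.comap (observation h (progMsg h a) l (Set.Iio k)) inferInstance))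
  split_ifs with hlk
  · subst hlk
    exact mutualInfo_progMsg_own hQ a hc hm hle h1
      (Finset.measurable_sum _ fun i _ => (h2 i.1 i.2).const_mul _)
  · exact (mutualInfo_progMsg_past hK hh a hlk hc hm hle h1 h2).2

theorem covForm_self_pos_of_progMsg (hK : 2 ≤ K) (hh : 0 ≤ h)
    (a : Fin K → Fin K → ℝ) (k : Fin K) {c : Sample K}
    (hc : ∀ ω, progMsg h a k ω = lin c ω) : 0 < covForm (σX2 : ℝ) (σQ2 : ℝ) c c := by
  have : Nontrivial (Fin K) := Fin.nontrivial_iff_two_le.2 hK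
  obtain ⟨l, hlk⟩ := exists_ne k
  obtain ⟨h1, h2⟩ := comap_observation_le_iff.1
    (le_refl (MeasurableSpace.comap (observation h (progMsg h a) l (Set.Iio k)) inferInstance))
  exact (mutualInfo_progMsg_past hK hh a hlk hc (measurable_observation_progMsg a l (Set.Iio k))
    (comap_observation_progMsg h a l (isLowerSet_Iio k)).le h1 h2).1

theorem half_logb_div_sub {s v w : ℝ} (hs : 0 < s) (hv : 0 < v) (hw : 0 < w) :
    1 / 2 * Real.logb 2 (s / v) - 1 / 2 * Real.logb 2 (s / w) = 1 / 2 * Real.logb 2 (w / v) := by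
  rw [Real.logb_div hs.ne' hv.ne', Real.logb_div hs.ne' hw.ne', Real.logb_div hw.ne' hv.ne']
  ring

/-- The least informed of the other agents is an earlier one, if there is any: its own message
tells it nothing new, so that of the `k.val` earlier messages it learns from `k.val - 1` only. For
the first agent there are no earlier messages, and the truncated subtraction gives `0` as well. -/
theorem progRate_eq (hK : 2 ≤ K) (hh : 0 ≤ h) (hQ : 0 < σQ2) (a : Fin K → Fin K → ℝ)
    (k : Fin K) :
    progRate K h σX2 σQ2 a k
      = 1 / 2 * Real.logb 2 (predError K h σX2 σQ2 (k.val - 1) / σQ2) := by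
  obtain ⟨c, hc⟩ := exists_lin_eq_progMsg h a k
  have hs := covForm_self_pos_of_progMsg (σX2 := σX2) (σQ2 := σQ2) hK hh a k hc
  have hpos := predError_pos hK hh σX2.coe_nonneg σQ2.coe_nonneg
  have hinf : ⨅ l : {l : Fin K // l ≠ k}, (mutualInfo (law K σX2 σQ2) (progMsg h a k)
        (measAndPast h (progMsg h a) l.1 k)).toReal
      = 1 / 2 * Real.logb 2 (covForm (σX2 : ℝ) (σQ2 : ℝ) c c
          / predError K h σX2 σQ2 (k.val - 1)) := by
    have hval (l : {l : Fin K // l ≠ k}) :=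
      (mutualInfo_progMsg_measAndPast (σX2 := σX2) hK hh hQ a l.1 k hc).2
    simp only [hval]
    have : Nontrivial (Fin K) := Fin.nontrivial_iff_two_le.2 hK
    have : Nonempty {l : Fin K // l ≠ k} := let ⟨l, hl⟩ := exists_ne k; ⟨⟨l, hl⟩⟩
    apply le_antisymm
    · obtain ⟨l, hl, hcard⟩ : ∃ l : Fin K, l ≠ k ∧
          ((Finset.Iio k).erase l).card = k.val - 1 := by
        rcases Nat.eq_zero_or_pos k.val with hk | hk
        · obtain ⟨l, hl⟩ := exists_ne k
          refine ⟨l, hl, ?_⟩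
          have := Finset.card_le_card (Finset.erase_subset l (Finset.Iio k))
          rw [Fin.card_Iio] at this
          omega
        · refine ⟨⟨0, by omega⟩, fun h0 => by simp [← h0] at hk, ?_⟩
          rw [Finset.card_erase_of_mem (by simpa [Fin.lt_def] using hk), Fin.card_Iio]
      refine (ciInf_le (Set.finite_range _).bddBelow ⟨l, hl⟩).trans ?_
      simp only [hcard, if_neg hl, le_refl]
    · refine le_ciInf fun l => ?_
      have hcard : k.val - 1 ≤ ((Finset.Iio k).erase l.1).card := by
        have := Finset.pred_card_le_card_erase (s := Finset.Iio k) (a := l.1)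
        rwa [Fin.card_Iio] at this
      have hanti := predError_antitone hK hh σX2.coe_nonneg σQ2.coe_nonneg hcard
      have h1 := hpos ((Finset.Iio k).erase l.1).card
      have h2 := hpos (k.val - 1)
      rw [if_neg l.2]
      gcongr
      norm_num
  rw [progRate, hinf, (mutualInfo_progMsg_measAndPast hK hh hQ a k k hc).2, if_pos rfl,
    half_logb_div_sub hs (NNReal.coe_pos.2 hQ) (hpos _)]

theorem progMsg_zero_eq_lin (k : Fin K) (ω : Sample K) :
    progMsg h 0 k ω = lin (msgVec h k) ω := by
  rw [progMsg_zero, lin_msgVec]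

/-- The value is that of `I(U_k; Y_k U_1 … U_{k-1})`: given `Y_k`, the past tells agent `k` nothing
about its local message. -/
theorem mutualInfo_localMsg_meas_own (hQ : 0 < σQ2) (k : Fin K) :
    mutualInfo (law K σX2 σQ2) (localMsg h k) (meas h k) ≠ ∞ ∧
      (mutualInfo (law K σX2 σQ2) (localMsg h k) (meas h k)).toReal
        = 1 / 2 * Real.logb 2
            (covForm (σX2 : ℝ) (σQ2 : ℝ) (msgVec h k) (msgVec h k) / σQ2) := by
  have := mutualInfo_progMsg_own (σX2 := σX2) (T := meas h k) hQ 0 (progMsg_zero_eq_lin k)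
    (measurable_meas h k)
    (measurable_iff_comap_le.1 (comap_observation_le_iff.1 le_rfl).1)
    (comap_measurable _) (by simp)
  rwa [progMsg_zero] at this

theorem localRate_eq_progRate (hK : 2 ≤ K) (hh : 0 ≤ h) (hQ : 0 < σQ2) (k : Fin K) :
    localRate K h σX2 σQ2 k = progRate K h σX2 σQ2 0 k := by
  have h1 := (mutualInfo_progMsg_measAndPast (σX2 := σX2) hK hh hQ 0 k k (progMsg_zero_eq_lin k)).2
  rw [if_pos rfl] at h1
  rw [progRate, h1, localRate, (mutualInfo_localMsg_meas_own hQ k).2, progMsg_zero]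

theorem localRate_eq_of_pos (hK : 2 ≤ K) (hh : 0 ≤ h) (hQ : 0 < σQ2) {k : Fin K}
    (hk : 0 < k.val) :
    localRate K h σX2 σQ2 k =
      (mutualInfo (law K σX2 σQ2) (localMsg h k) (meas h k)).toReal
        - (mutualInfo (law K σX2 σQ2) (localMsg h k)
            (measAndPast h (localMsg h) ⟨0, by omega⟩ k)).toReal := by
  have h1 := (mutualInfo_progMsg_measAndPast (σX2 := σX2) hK hh hQ 0 ⟨0, by omega⟩ k
    (progMsg_zero_eq_lin k)).2
  rw [if_neg (fun h0 => by simp [← h0] at hk),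
    Finset.card_erase_of_mem (by simpa [Fin.lt_def] using hk), Fin.card_Iio, progMsg_zero] at h1
  rw [localRate_eq_progRate hK hh hQ, progRate_eq hK hh hQ, h1,
    (mutualInfo_localMsg_meas_own hQ k).2, half_logb_div_sub
      (covForm_self_pos_of_progMsg hK hh 0 k (progMsg_zero_eq_lin k)) (NNReal.coe_pos.2 hQ)
      (predError_pos hK hh σX2.coe_nonneg σQ2.coe_nonneg _)]

theorem localRate_eq_of_eq_zero (hK : 2 ≤ K) (hh : 0 ≤ h) (hQ : 0 < σQ2) {k : Fin K}
    (hk : k.val = 0) :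
    localRate K h σX2 σQ2 k =
      (mutualInfo (law K σX2 σQ2) (localMsg h k) (meas h k)).toReal
        - (mutualInfo (law K σX2 σQ2) (localMsg h k) (meas h ⟨1, by omega⟩)).toReal := by
  have h1 := (mutualInfo_progMsg_past (σX2 := σX2) (σQ2 := σQ2) (T := meas h ⟨1, by omega⟩)
    hK hh 0 (fun h0 => by simp [← h0] at hk) (progMsg_zero_eq_lin k) (measurable_meas h _)
    (measurable_iff_comap_le.1 (comap_observation_le_iff.1 le_rfl).1)
    (comap_measurable _) (fun j hj => by rw [Fin.lt_def] at hj; omega)).2.2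
  have hcard : ((Finset.Iio k).erase ⟨1, by omega⟩).card = k.val - 1 := by
    have := Finset.card_le_card (Finset.erase_subset (⟨1, by omega⟩ : Fin K) (Finset.Iio k))
    rw [Fin.card_Iio] at this
    omega
  rw [progMsg_zero, hcard] at h1
  rw [localRate_eq_progRate hK hh hQ, progRate_eq hK hh hQ, h1,
    (mutualInfo_localMsg_meas_own hQ k).2, half_logb_div_sub
      (covForm_self_pos_of_progMsg hK hh 0 k (progMsg_zero_eq_lin k)) (NNReal.coe_pos.2 hQ)
      (predError_pos hK hh σX2.coe_nonneg σQ2.coe_nonneg _)]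

end Rates

/-! ### Leakages -/

/-- Given `Y_j`, the message `U_j` tells nothing more about `X_k`, and by symmetry the messages of
the agents other than `j` and `k` enter the best linear estimate of `X_k` with a common weight
`z`. -/
theorem exists_stateEstimate (hK : 2 ≤ K) {h σX2 σQ2 : ℝ} (hh : 0 ≤ h) (hσ : 0 ≤ σX2)
    (hQ : 0 ≤ σQ2) {k j : Fin K} (hkj : k ≠ j) : ∃ (x y z : ℝ) (e : Sample K),
      e = stateVec k - (x • measVec h j + y • msgVec h k
        + z • ∑ i ∈ (Finset.univ.erase k).erase j, msgVec h i) ∧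
      covForm σX2 σQ2 e (measVec h j) = 0 ∧
      (∀ i, covForm σX2 σQ2 e (msgVec h i) = 0) ∧
      covForm σX2 σQ2 e e = σX2 - (x * (Real.sqrt h * σX2) + y * σX2
        + z * ((K - 2) * (Real.sqrt h * σX2))) ∧
      z = (Real.sqrt h * σX2 - beta K h σX2 * (σX2 - Real.sqrt h * σX2)
            / (alpha K h σX2 - beta K h σX2 + σQ2))
          / (alpha K h σX2 - beta K h σX2 + σQ2 + (K - 1) * beta K h σX2
            + (alpha K h σX2 - beta K h σX2 + σQ2) * beta K h σX2
              / (alpha K h σX2 - beta K h σX2)) ∧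
      y = z + (σX2 - Real.sqrt h * σX2) / (alpha K h σX2 - beta K h σX2 + σQ2) ∧
      x = z * (alpha K h σX2 - beta K h σX2 + σQ2) / (alpha K h σX2 - beta K h σX2) := by
  set F := (Finset.univ.erase k).erase j with hF
  have hm : (F.card : ℝ) = K - 2 := by
    rw [hF, Finset.card_erase_of_mem (by simpa using hkj.symm),
      Finset.card_erase_of_mem (Finset.mem_univ k), Finset.card_univ, Fintype.card_fin,
      Nat.sub_sub, Nat.cast_sub hK]
    norm_num
  have hjF : j ∉ F := Finset.notMem_erase _ _
  have hkF : k ∉ F := by simp [hF]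
  have hK2 : (0 : ℝ) ≤ K - 1 := by
    have : (2 : ℝ) ≤ K := by exact_mod_cast hK
    linarith
  have hβ := beta_nonneg hK hh hσ
  have hαβ := one_le_alpha_sub_beta (K := K) hh hσ
  set α := alpha K h σX2 with hαd
  set β := beta K h σX2 with hβd
  set γ := Real.sqrt h * σX2 with hγ
  have hδ : 0 < α - β := by linarith
  set p := α - β + σQ2 with hpd
  have hp : 0 < p := by linarith
  have hD : 0 < p + (K - 1) * β + p * β / (α - β) := by positivity
  set z := (γ - β * (σX2 - γ) / p) / (p + (K - 1) * β + p * β / (α - β)) with hz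
  set y := z + (σX2 - γ) / p with hy
  set x := z * p / (α - β) with hx
  have hzD : z * (p + (K - 1) * β + p * β / (α - β)) = γ - β * (σX2 - γ) / p := by
    rw [hz, div_mul_cancel₀ _ hD.ne']
  -- the normal equations for `Y_j`, for `U_k` and for the other messages
  have e3 : γ - (x * β + y * β + z * (p + (K - 2) * β)) = 0 := by
    rw [hx, hy]; linear_combination -hzD
  have e1 : γ - (x * α + y * β + z * ((K - 2) * β)) = 0 := by
    have : x * (α - β) = z * p := by rw [hx]; field_simp
    linear_combination e3 - this
  have e2 : σX2 - (x * β + y * (p + β) + z * ((K - 2) * β)) = 0 := by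
    have : y * p = z * p + (σX2 - γ) := by rw [hy]; field_simp
    linear_combination e3 - this
  have hmeas (i : Fin K) (hi : i = j) :
      covForm σX2 σQ2 (stateVec k - (x • measVec h j + y • msgVec h k + z • ∑ i ∈ F, msgVec h i))
        (measVec h i) = 0 := by
    subst hi
    simp only [map_sub, map_add, map_smul, map_sum, LinearMap.sub_apply, LinearMap.add_apply,
      LinearMap.smul_apply, LinearMap.sum_apply, covForm_stateVec_measVec,
      covForm_msgVec_measVec hh, covForm_measVec_measVec hh, smul_eq_mul,
      Finset.sum_add_distrib, Finset.sum_const, nsmul_eq_mul, Finset.sum_ite_eq', hjF, hkj, hm,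
      if_true, if_false]
    linear_combination e1
  have hmsg (i : Fin K) :
      covForm σX2 σQ2 (stateVec k - (x • measVec h j + y • msgVec h k + z • ∑ i ∈ F, msgVec h i))
        (msgVec h i) = 0 := by
    simp only [map_sub, map_add, map_smul, map_sum, LinearMap.sub_apply, LinearMap.add_apply,
      LinearMap.smul_apply, LinearMap.sum_apply, covForm_stateVec_msgVec,
      covForm_msgVec_msgVec hh, covForm_measVec_msgVec hh, smul_eq_mul,
      Finset.sum_add_distrib, Finset.sum_const, nsmul_eq_mul, Finset.sum_ite_eq', hm]
    by_cases hij : i = j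
    · subst hij
      simp only [hjF, hkj, if_true, if_false]
      linear_combination e1
    · by_cases hik : i = k
      · subst hik
        simp only [hkF, hkj.symm, if_true, if_false]
        linear_combination e2
      · have hiF : i ∈ F := by simp [hF, hij, hik]
        simp only [hiF, Ne.symm hij, Ne.symm hik, if_true, if_false]
        linear_combination e3
  refine ⟨x, y, z, _, rfl, hmeas j rfl, hmsg, ?_, rfl, rfl, rfl⟩
  have hself : covForm σX2 σQ2
      (stateVec k - (x • measVec h j + y • msgVec h k + z • ∑ i ∈ F, msgVec h i)) (stateVec k)
      = σX2 - (x * γ + y * σX2 + z * ((K - 2) * γ)) := by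
    rw [covForm_comm]
    simp only [map_sub, map_add, map_smul, map_sum, covForm_stateVec_measVec,
      covForm_stateVec_msgVec, covForm_stateVec_stateVec, smul_eq_mul,
      Finset.sum_add_distrib, Finset.sum_const, nsmul_eq_mul, Finset.sum_ite_eq, hkF, hkj, hm,
      if_true, if_false]
    ring
  rw [map_sub, hself, map_add, map_add, map_smul, map_smul, map_smul, map_sum, hmeas j rfl,
    hmsg k, Finset.sum_eq_zero fun i _ => hmsg i]
  simp

/-- No state is a function of the measurements and messages: every measurement contains a
nondegenerate noise of its own, so that only the trivial estimate avoids them all. -/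
theorem covForm_stateEstimate_pos {h : ℝ} {σX2 σQ2 : ℝ≥0} (hσ : 0 < σX2) {k j : Fin K}
    (hkj : k ≠ j) (x y z : ℝ) :
    0 < covForm (σX2 : ℝ) (σQ2 : ℝ) (stateVec k - (x • measVec h j + y • msgVec h k
          + z • ∑ i ∈ (Finset.univ.erase k).erase j, msgVec h i))
        (stateVec k - (x • measVec h j + y • msgVec h k
          + z • ∑ i ∈ (Finset.univ.erase k).erase j, msgVec h i)) := by
  refine lt_of_le_of_ne (covForm_self_nonneg _ _ _) fun h0 => ?_
  obtain ⟨h1, h2⟩ := fst_snd_fst_eq_zero_of_covForm_self_eq_zero hσ h0.symm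
  have hn (i : Fin K) := congrFun h2 i
  simp only [stateVec, measVec, msgVec, quantVec, Prod.snd_sub, Prod.fst_sub, Prod.snd_add,
    Prod.fst_add, Prod.smul_snd, Prod.smul_fst, Prod.snd_sum, Prod.fst_sum, Pi.sub_apply,
    Pi.add_apply, Pi.smul_apply, Finset.sum_apply, Pi.zero_apply, Pi.single_apply, smul_eq_mul,
    Finset.sum_ite_eq, add_zero, Finset.mem_erase, Finset.mem_univ, and_true] at hn
  have hx : x = 0 := by simpa [hkj, hkj.symm] using hn j
  have hy : y = 0 := by simpa [hkj, hkj.symm] using hn k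
  have hz : z • ∑ i ∈ (Finset.univ.erase k).erase j, msgVec h i = 0 := by
    rcases ((Finset.univ.erase k).erase j).eq_empty_or_nonempty with hF | ⟨i, hi⟩
    · simp [hF]
    · have hi' : i ≠ j ∧ i ≠ k := by simpa using hi
      have : z = 0 := by simpa [hi', hx, hy] using hn i
      simp [this]
  have := congrFun h1 k
  simp [hx, hy, hz, stateVec] at this

/-- The variance of the estimation error of `exists_stateEstimate` in closed form, with
`γ = E[X_k Y_j]`. Up to a common factor, both sides are the determinant of the covariance matrix of
`X_k`, `Y_j` and the messages of the agents other than `j`: on the left as the error variance times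
the determinant for the observations, on the right as the variance of `X_k` times the determinant
of the conditional covariances given `X_k`. -/
theorem stateEstimate_variance_mul {α β γ s σ K x y z : ℝ} (hα : α ≠ 0) (hs : s ≠ 0)
    (hδ : α - β ≠ 0) (hp : α - β + σ ≠ 0) (hw : α - s + σ ≠ 0)
    (hD : α - β + σ + (K - 1) * β + (α - β + σ) * β / (α - β) ≠ 0)
    (hz : z = (γ - β * (s - γ) / (α - β + σ))
      / (α - β + σ + (K - 1) * β + (α - β + σ) * β / (α - β)))
    (hy : y = z + (s - γ) / (α - β + σ)) (hx : x = z * (α - β + σ) / (α - β)) :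
    (s - (x * γ + y * s + z * ((K - 2) * γ)))
        * (α * (α - β + σ) * (α + (K - 2) * β - (K - 1) * (β ^ 2 / α) + σ))
      = s * ((α - s + σ) * ((α - β)
          * (α + (K - 2) * β - (K - 1) * ((β - γ) ^ 2 / (α - s + σ) + γ ^ 2 / s) + σ)
          + σ * (β - ((β - γ) ^ 2 / (α - s + σ) + γ ^ 2 / s)))) := by
  have hD' : (α - β + σ + (K - 1) * β) * (α - β) + (α - β + σ) * β ≠ 0 := by
    intro h0
    apply hD
    field_simp
    linear_combination h0
  have hz' : z = (γ * (α - β + σ) - β * (s - γ)) * (α - β)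
      / (((α - β + σ + (K - 1) * β) * (α - β) + (α - β + σ) * β) * (α - β + σ)) := by
    rw [hz]; field_simp
  rw [hx, hy, hz']
  obtain ⟨D, hDe⟩ : ∃ D, D = (α - β + σ + (K - 1) * β) * (α - β) + (α - β + σ) * β := ⟨_, rfl⟩
  rw [← hDe] at hD' ⊢
  field_simp
  subst hDe
  ring

theorem leakage_progMsg (hK : 2 ≤ K) {h : ℝ} (hh : 0 ≤ h) {σX2 σQ2 : ℝ≥0} (hσ : 0 < σX2)
    (a : Fin K → Fin K → ℝ) {k j : Fin K} (hkj : k ≠ j) :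
    leakage h σX2 σQ2 (progMsg h a) k j ≠ ∞ ∧
      (leakage h σX2 σQ2 (progMsg h a) k j).toReal =
        1 / 2 * Real.logb 2
          (alpha K h σX2 * (alpha K h σX2 - beta K h σX2 + σQ2)
              * (f1 K h σX2 (beta K h σX2 ^ 2 / alpha K h σX2) + σQ2)
            / ((alpha K h σX2 - σX2 + σQ2)
              * ((alpha K h σX2 - beta K h σX2) * (f1 K h σX2 (c5 K h σX2 σQ2) + σQ2)
                + σQ2 * (beta K h σX2 - c5 K h σX2 σQ2)))) := by
  have hσ' : (0 : ℝ) < σX2 := hσ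
  have hQ : (0 : ℝ) ≤ σQ2 := σQ2.coe_nonneg
  obtain ⟨x, y, z, e, he, h1, h2, h3, hz, hy, hx⟩ :=
    exists_stateEstimate hK hh hσ'.le hQ hkj
  have hpos : 0 < covForm (σX2 : ℝ) (σQ2 : ℝ) e e :=
    he ▸ covForm_stateEstimate_pos hσ hkj x y z
  have hcomap : MeasurableSpace.comap (measAndAll h (progMsg h a) j) inferInstance
      = MeasurableSpace.comap (observation h (localMsg h) j Set.univ) inferInstance := by
    rw [comap_measAndAll, comap_observation_progMsg h a j isLowerSet_univ]
  have hTm : Measurable (measAndAll h (progMsg h a) j) :=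
    (measurable_meas h j).prodMk (measurable_pi_iff.2 fun i => measurable_progMsg h a i)
  have hG : Measurable[MeasurableSpace.comap (measAndAll h (progMsg h a) j) inferInstance]
      (fun ω => state k ω - lin e ω) := by
    have hest : (fun ω => state k ω - lin e ω) = fun ω =>
        x * meas h j ω + y * localMsg h k ω
          + z * ∑ i ∈ (Finset.univ.erase k).erase j, localMsg h i ω := by
      ext ω
      simp only [he, map_sub, map_add, map_smul, map_sum, sub_apply, add_apply, smul_apply,
        sum_apply, lin_stateVec, lin_measVec, lin_msgVec, smul_eq_mul]
      ring
    obtain ⟨m1, m2⟩ := comap_observation_le_iff.1 hcomap.ge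
    rw [hest]
    exact ((m1.const_mul _).add ((m2 k trivial).const_mul _)).add
      ((Finset.measurable_sum _ fun i _ => m2 i trivial).const_mul _)
  obtain ⟨-, hfin, hval⟩ := mutualInfo_of_estimate hTm hcomap.le
    (fun ω => (lin_stateVec k ω).symm) h1 (fun i _ => h2 i) hpos hG
  refine ⟨hfin, hval.trans ?_⟩
  have hα := alpha_pos hK hh hσ'.le
  have hβ := beta_nonneg hK hh hσ'.le
  have hαβ := one_le_alpha_sub_beta (K := K) hh hσ'.le
  have hαs := one_le_alpha_sub_variance hK hh hσ'.le
  have hq := beta_sub_sq_div_alpha_nonneg hK hh hσ'.le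
  have hK1 : (0 : ℝ) ≤ K - 1 := by
    have : (2 : ℝ) ≤ K := by exact_mod_cast hK
    linarith
  rw [covForm_stateVec_stateVec]
  rw [h3] at hpos ⊢
  have hc5 : c5 K h σX2 σQ2 = (beta K h σX2 - Real.sqrt h * σX2) ^ 2
      / (alpha K h σX2 - σX2 + σQ2) + (Real.sqrt h * σX2) ^ 2 / (σX2 : ℝ) := by
    rw [c5, mul_pow, Real.sq_sqrt hh]
    field_simp
  rw [hc5]
  simp only [f1]
  set α := alpha K h σX2
  set β := beta K h σX2
  have hδ : 0 < α - β := by linarith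
  have hp : 0 < α - β + σQ2 := by linarith
  have hw : 0 < α - σX2 + σQ2 := by linarith
  have hD : 0 < α - β + σQ2 + (K - 1) * β + (α - β + σQ2) * β / (α - β) := by positivity
  have hid := stateEstimate_variance_mul hα.ne' hσ'.ne' hδ.ne' hp.ne' hw.ne' hD.ne' hz hy hx
  have hf : 0 < α + (K - 2) * β - (K - 1) * (β ^ 2 / α) + σQ2 := by
    linarith [mul_nonneg hK1 hq]
  have hnum : 0 < α * (α - β + σQ2) * (α + (K - 2) * β - (K - 1) * (β ^ 2 / α) + σQ2) := by
    positivity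
  have hden := (mul_pos_iff_of_pos_left hσ').1 (hid ▸ mul_pos hpos hnum)
  congr 2
  rw [div_eq_div_iff hpos.ne' hden.ne', ← hid]
  ring

theorem leakage_progMsg_eq_localMsg (hK : 2 ≤ K) {h : ℝ} (hh : 0 ≤ h) {σX2 σQ2 : ℝ≥0}
    (hσ : 0 < σX2) (a : Fin K → Fin K → ℝ) {k j : Fin K} (hkj : k ≠ j) :
    leakage h σX2 σQ2 (progMsg h a) k j = leakage h σX2 σQ2 (localMsg h) k j := by
  obtain ⟨h1, h2⟩ := leakage_progMsg (σQ2 := σQ2) hK hh hσ a hkj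
  obtain ⟨h1', h2'⟩ := leakage_progMsg (σQ2 := σQ2) hK hh hσ 0 hkj
  rw [← progMsg_zero h, ← ENNReal.toReal_eq_toReal_iff' h1 h1', h2, h2']

theorem localRegion_eq_progRegion (hK : 2 ≤ K) {h : ℝ} (hh : 0 ≤ h) {σX2 : ℝ≥0}
    (hσ : 0 < σX2) : localRegion K h σX2 = progRegion K h σX2 := by
  have hrate {σQ2 : ℝ≥0} (hQ : 0 < σQ2) (a : Fin K → Fin K → ℝ) (k : Fin K) :
      progRate K h σX2 σQ2 a k = localRate K h σX2 σQ2 k := by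
    rw [localRate_eq_progRate hK hh hQ, progRate_eq hK hh hQ, progRate_eq hK hh hQ]
  ext t
  constructor
  · rintro ⟨σQ2, hQ, hR, hD, hL⟩
    exact ⟨σQ2, hQ, 0, fun k => (hrate hQ 0 k).trans_le (hR k),
      fun k => (distortion_progMsg h σX2 σQ2 0 k).trans_le (hD k),
      fun p => (leakage_progMsg_eq_localMsg hK hh hσ 0 p.2).trans_le (hL p)⟩
  · rintro ⟨σQ2, hQ, a, hR, hD, hL⟩
    exact ⟨σQ2, hQ, fun k => (hrate hQ a k).symm.trans_le (hR k),
      fun k => (distortion_progMsg h σX2 σQ2 a k).symm.trans_le (hD k),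
      fun p => (leakage_progMsg_eq_localMsg hK hh hσ a p.2).symm.trans_le (hL p)⟩

end MultiAgent

open MultiAgent in
theorem theorem2 (K : ℕ) (hK : 2 ≤ K) (h : ℝ) (hh : 0 < h) (σX2 : ℝ≥0) (hσX2 : 0 < σX2) :
    -- the achieved rate-distortion-leakage tuples are the same
    localRegion K h σX2 = progRegion K h σX2 ∧
    -- the rates agree, and all the mutual informations they are made of are finite
    (∀ (σQ2 : ℝ≥0), 0 < σQ2 → ∀ (a : Fin K → Fin K → ℝ) (k : Fin K),
      mutualInfo (law K σX2 σQ2) (localMsg h k) (meas h k) ≠ ∞ ∧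
      (∀ l : Fin K, mutualInfo (law K σX2 σQ2) (localMsg h k)
        (measAndPast h (localMsg h) l k) ≠ ∞) ∧
      (∀ l : Fin K, mutualInfo (law K σX2 σQ2) (progMsg h a k)
        (measAndPast h (progMsg h a) l k) ≠ ∞) ∧
      progRate K h σX2 σQ2 a k = localRate K h σX2 σQ2 k ∧
      (k.val = 0 → localRate K h σX2 σQ2 k =
        (mutualInfo (law K σX2 σQ2) (localMsg h k) (meas h k)).toReal
          - (mutualInfo (law K σX2 σQ2) (localMsg h k) (meas h ⟨1, by omega⟩)).toReal) ∧
      (0 < k.val → localRate K h σX2 σQ2 k =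
        (mutualInfo (law K σX2 σQ2) (localMsg h k) (meas h k)).toReal
          - (mutualInfo (law K σX2 σQ2) (localMsg h k)
              (measAndPast h (localMsg h) ⟨0, by omega⟩ k)).toReal)) ∧
    -- the distortions agree
    (∀ (σQ2 : ℝ≥0) (a : Fin K → Fin K → ℝ) (k : Fin K),
      distortion h σX2 σQ2 (progMsg h a) k = distortion h σX2 σQ2 (localMsg h) k) ∧
    -- the leakages agree, are finite, and have a closed form
    (∀ (σQ2 : ℝ≥0) (a : Fin K → Fin K → ℝ) (k j : Fin K), k ≠ j →
      leakage h σX2 σQ2 (progMsg h a) k j = leakage h σX2 σQ2 (localMsg h) k j ∧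
      leakage h σX2 σQ2 (localMsg h) k j ≠ ∞ ∧
      (leakage h σX2 σQ2 (localMsg h) k j).toReal =
        1 / 2 * Real.logb 2
          (alpha K h σX2 * (alpha K h σX2 - beta K h σX2 + σQ2)
              * (f1 K h σX2 (beta K h σX2 ^ 2 / alpha K h σX2) + σQ2)
            / ((alpha K h σX2 - σX2 + σQ2)
              * ((alpha K h σX2 - beta K h σX2) * (f1 K h σX2 (c5 K h σX2 σQ2) + σQ2)
                + σQ2 * (beta K h σX2 - c5 K h σX2 σQ2))))) ∧
    -- the closed form in the limiting case of no quantization noise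
    (∀ (a : Fin K → Fin K → ℝ) (k j : Fin K), k ≠ j →
      (leakage h σX2 0 (progMsg h a) k j).toReal =
        1 / 2 * Real.logb 2
          (alpha K h σX2 * f1 K h σX2 (beta K h σX2 ^ 2 / alpha K h σX2)
            / ((alpha K h σX2 - σX2) * f1 K h σX2 (c5 K h σX2 0)))) := by
  refine ⟨localRegion_eq_progRegion hK hh.le hσX2, fun σQ2 hQ a k => ?_,
    fun σQ2 a k => distortion_progMsg h σX2 σQ2 a k, fun σQ2 a k j hkj => ?_,
    fun a k j hkj => ?_⟩
  · obtain ⟨c, hc⟩ := exists_lin_eq_progMsg h a k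
    refine ⟨(mutualInfo_localMsg_meas_own hQ k).1, fun l => ?_,
      fun l => (mutualInfo_progMsg_measAndPast hK hh.le hQ a l k hc).1, ?_,
      localRate_eq_of_eq_zero hK hh.le hQ, localRate_eq_of_pos hK hh.le hQ⟩
    · have := (mutualInfo_progMsg_measAndPast (σX2 := σX2) hK hh.le hQ 0 l k
        (progMsg_zero_eq_lin k)).1
      rwa [progMsg_zero] at this
    · rw [localRate_eq_progRate hK hh.le hQ, progRate_eq hK hh.le hQ, progRate_eq hK hh.le hQ]
  · have := leakage_progMsg (σQ2 := σQ2) hK hh.le hσX2 0 hkj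
    rw [progMsg_zero] at this
    exact ⟨leakage_progMsg_eq_localMsg hK hh.le hσX2 a hkj, this⟩
  · have hδ : alpha K h σX2 - beta K h σX2 ≠ 0 := by
      linarith [one_le_alpha_sub_beta (K := K) hh.le σX2.coe_nonneg]
    rw [(leakage_progMsg hK hh.le hσX2 a hkj).2]
    simp only [NNReal.coe_zero, add_zero, zero_mul]
    -- without quantization noise the common factor `α - β` cancels
    rw [mul_right_comm, mul_left_comm (alpha K h σX2 - σX2),
      mul_comm _ (alpha K h σX2 - beta K h σX2), mul_div_mul_left _ _ hδ]
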